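/- Let $\mathfrak{gl}_\infty$ be the Lie algebra of doubly infinite complex matrices with finitely many nonzero entries, with basis the matrix units $E_{m,n}$ ($m,n\in\mathbb Z$), and let $H=\mathrm{span}\{E_{n,n} : n\in\mathbb Z\}$. For a finite nonempty $T\subset\mathbb Z$ put $\mathfrak{gl}_T=\mathrm{span}\{E_{m,n} : m,n\in T\}$, and let $P_+(T)$ be the set of $\lambda\in H^*$ such that $\lambda_i:=\lambda(E_{i,i})\in\mathbb N$ for all $i\in\mathbb Z$, $\lambda_i=0$ for $i\notin T$, and $\lambda_i\ge\lambda_j$ for $i<j$ in $T$. For $\lambda\in P_+(T)$ let $L(\lambda_T)$ be the irreducible highest weight $\mathfrak{gl}_T$-module with highest weight $\lambda|_{\mathrm{span}\{E_{n,n}:n\in T\}}$ (the irreducible quotient of the Verma module, with respect to the raising operators $E_{m,n}$, $m<n$ in $T$). Let $L(T,\lambda)$ be the irreducible quotient of the $\mathfrak{gl}_\infty$-module induced from $L(\lambda_T)$, on which all $E_{m,n}$ with $m\in\mathbb Z$, $n\notin T$ are made to act as zero. **Theorem 4.4.** Let $r\le n$ be integers, $S=\{r,r+1,\dots,n\}$,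 and $\lambda,\mu\in P_+(S)$. Then $L(S,\lambda)\otimes L(S,\mu)$ is a cyclic $\mathfrak{gl}_\infty$-module (it is generated by one vector). Furthermore, there is an integer $k\ge n$ such that for every integer $\bar n\ge k$, with $\bar S=\{r,r+1,\dots,\bar n\}$, the decomposition of $L(S,\lambda)\otimes L(S,\mu)$ into irreducible $\mathfrak{gl}_\infty$-modules agrees with the decomposition of $L(\lambda_{\bar S})\otimes L(\mu_{\bar S})$ into irreducible $\mathfrak{gl}_{\bar S}$-modules: there are finitely many weights $\nu^1,\dots,\nu^N\in P_+(\bar S)$ such that $$L(S,\lambda)\otimes L(S,\mu)\simeq\bigoplus_{i=1}^N L(\bar S,\nu^i)\ \text{ over }\mathfrak{gl}_\infty,\qquad L(\lambda_{\bar S})\otimes L(\mu_{\bar S})\simeq\bigoplus_{i=1}^N L(\nu^i_{\bar S})\ \text{ over }\mathfrak{gl}_{\bar S},$$ where all the summands are irreducible; and for every family $(\nu^\alpha)_{\alpha\in I}$ in $P_+(\bar S)$, $L(S,\lambda)\otimes L(S,\mu)\simeq\bigoplus_{\alpha\in I} L(\bar S,\nu^\alpha)$ over $\mathfrak{gl}_\infty$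 if and only if $L(\lambda_{\bar S})\otimes L(\mu_{\bar S})\simeq\bigoplus_{\alpha\in I} L(\nu^\alpha_{\bar S})$ over $\mathfrak{gl}_{\bar S}$. In particular, $L(S,\lambda)\otimes L(S,\mu)$ is a finite direct sum of irreducible $\mathfrak{gl}_\infty$-modules. -/

import Mathlib

open scoped TensorProduct DirectSum

noncomputable section

namespace GlInfty

attribute [local instance] LieRing.ofAssociativeRing LieAlgebra.ofAssociativeAlgebra

/-! ### The Lie algebra of doubly infinite matrices with finitely many nonzero entries

A doubly infinite matrix with finitely many nonzero entries is identified with the operator by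
which it acts on column vectors. -/

/-- The space of doubly infinite column vectors with finitely many nonzero entries. -/
def Vec : Type := ℤ →₀ ℂ

instance : AddCommGroup Vec := inferInstanceAs (AddCommGroup (ℤ →₀ ℂ))
instance : Module ℂ Vec := inferInstanceAs (Module ℂ (ℤ →₀ ℂ))

/-- The matrix unit: it sends the unit vector at `n` to the unit vector at `m`, and it kills the
other unit vectors. -/
def unit (m n : ℤ) : Module.End ℂ Vec :=
  (Finsupp.lsingle m : ℂ →ₗ[ℂ] (ℤ →₀ ℂ)) ∘ₗ (Finsupp.lapply n : (ℤ →₀ ℂ) →ₗ[ℂ] ℂ)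

theorem unit_mul (m n r s : ℤ) :
    unit m n * unit r s = if n = r then unit m s else 0 := by
  refine LinearMap.ext fun v => ?_
  change Finsupp.single m ((Finsupp.single r (Finsupp.toFun v s) : ℤ →₀ ℂ) n) = _
  by_cases h : n = r
  · subst h
    rw [if_pos rfl, Finsupp.single_eq_same]
    rfl
  · rw [if_neg h, Finsupp.single_eq_of_ne h, Finsupp.single_zero]
    rfl

theorem unit_lie (m n r s : ℤ) :
    ⁅unit m n, unit r s⁆ =
      (if n = r then unit m s else 0) - (if m = s then unit r n else 0) := by
  rw [LieRing.of_associative_ring_bracket, unit_mul, unit_mul]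
  simp only [eq_comm (a := s)]

theorem span_lie_mem {L : Type*} [LieRing L] [LieAlgebra ℂ L] {X : Set L}
    (hX : ∀ x ∈ X, ∀ y ∈ X, ⁅x, y⁆ ∈ Submodule.span ℂ X) {a b : L}
    (ha : a ∈ Submodule.span ℂ X) (hb : b ∈ Submodule.span ℂ X) :
    ⁅a, b⁆ ∈ Submodule.span ℂ X := by
  induction ha using Submodule.span_induction with
  | mem x hx =>
    induction hb using Submodule.span_induction with
    | mem y hy => exact hX x hx y hy
    | zero => simp
    | add y z _ _ h1 h2 => rw [lie_add]; exact add_mem h1 h2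
    | smul c y _ h => rw [lie_smul]; exact Submodule.smul_mem _ c h
  | zero => simp
  | add y z _ _ h1 h2 => rw [add_lie]; exact add_mem h1 h2
  | smul c y _ h => rw [smul_lie]; exact Submodule.smul_mem _ c h

/-- The Lie algebra `𝔤𝔩_∞` of doubly infinite complex matrices with finitely many nonzero entries,
under the commutator bracket. -/
def gl : LieSubalgebra ℂ (Module.End ℂ Vec) where
  toSubmodule := Submodule.span ℂ {x | ∃ m n : ℤ, x = unit m n}
  lie_mem' := by
    intro a b ha hb
    refine span_lie_mem ?_ ha hb
    rintro _ ⟨m, n, rfl⟩ _ ⟨r, s, rfl⟩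
    rw [unit_lie]
    refine Submodule.sub_mem _ ?_ ?_ <;> split_ifs
    · exact Submodule.subset_span ⟨_, _, rfl⟩
    · exact zero_mem _
    · exact Submodule.subset_span ⟨_, _, rfl⟩
    · exact zero_mem _

/-- The basis element `E_{m,n}` of `𝔤𝔩_∞`. -/
def E (m n : ℤ) : gl := ⟨unit m n, Submodule.subset_span ⟨m, n, rfl⟩⟩

theorem E_lie (m n r s : ℤ) :
    ⁅E m n, E r s⁆ = (if n = r then E m s else 0) - (if m = s then E r n else 0) := by
  apply Subtype.ext
  have h := unit_lie m n r s
  split_ifs at h ⊢ <;> simpa [E] using h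

/-- The subalgebra `𝔤𝔩_S` of `𝔤𝔩_∞` spanned by the `E_{m,n}` with `m, n ∈ S`. -/
def glS (S : Finset ℤ) : LieSubalgebra ℂ gl where
  toSubmodule := Submodule.span ℂ {x | ∃ m ∈ S, ∃ n ∈ S, x = E m n}
  lie_mem' := by
    intro a b ha hb
    refine span_lie_mem ?_ ha hb
    rintro _ ⟨m, hm, n, hn, rfl⟩ _ ⟨r, hr, s, hs, rfl⟩
    rw [E_lie]
    refine sub_mem ?_ ?_ <;> split_ifs
    · exact Submodule.subset_span ⟨m, hm, s, hs, rfl⟩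
    · exact zero_mem _
    · exact Submodule.subset_span ⟨r, hr, n, hn, rfl⟩
    · exact zero_mem _

/-- `E_{m,n}` as an element of `𝔤𝔩_S`, for `m, n ∈ S`. -/
def ES {S : Finset ℤ} {m n : ℤ} (hm : m ∈ S) (hn : n ∈ S) : glS S :=
  ⟨E m n, Submodule.subset_span ⟨m, hm, n, hn, rfl⟩⟩

/-! ### Weights -/

/-- The Cartan subalgebra `H = span {E_{n,n}}` (as a vector space). -/
def cartan : Submodule ℂ gl := Submodule.span ℂ {x | ∃ n : ℤ, x = E n n}

/-- The dual space `H^*`. -/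
abbrev Weight : Type := Module.Dual ℂ cartan

/-- The value `λ_n = λ(E_{n,n})`. -/
def Weight.val (lam : Weight) (n : ℤ) : ℂ :=
  lam ⟨E n n, Submodule.subset_span ⟨n, rfl⟩⟩

/-- `P_+(S)`: the weights `λ` for which all `λ_i` are in `ℕ`, `λ_i = 0` for `i ∉ S`, and
`λ_i ≥ λ_j` for `i < j` in `S`. -/
def Pplus (S : Finset ℤ) : Set Weight :=
  {lam | ∃ f : ℤ → ℕ, (∀ i, lam.val i = f i) ∧ (∀ i, i ∉ S → f i = 0) ∧
    ∀ i ∈ S, ∀ j ∈ S, i < j → f j ≤ f i}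

/-! ### Modules over the enveloping algebra as Lie modules; irreducible quotients -/

/-- A module over `U(𝔤)` is a `𝔤`-module through `𝔤 → U(𝔤)`. -/
@[reducible] def envLieRingModule (g M : Type*) [LieRing g] [LieAlgebra ℂ g] [AddCommGroup M]
    [Module (UniversalEnvelopingAlgebra ℂ g) M] : LieRingModule g M where
  bracket x m := UniversalEnvelopingAlgebra.ι ℂ x • m
  add_lie x y m := by simp only [map_add, add_smul]
  lie_add x m n := by simp only [smul_add]
  leibniz_lie x y m := by
    rw [LieHom.map_lie, LieRing.of_associative_ring_bracket, sub_smul, mul_smul, mul_smul]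
    abel

theorem envLieModule (g M : Type*) [LieRing g] [LieAlgebra ℂ g] [AddCommGroup M] [Module ℂ M]
    [Module (UniversalEnvelopingAlgebra ℂ g) M]
    [IsScalarTower ℂ (UniversalEnvelopingAlgebra ℂ g) M] :
    letI := envLieRingModule g M
    LieModule ℂ g M := by
  let _ := envLieRingModule g M
  refine ⟨fun t x m => ?_, fun t x m => ?_⟩
  · change UniversalEnvelopingAlgebra.ι ℂ (t • x) • m = t • (UniversalEnvelopingAlgebra.ι ℂ x • m)
    rw [map_smul, smul_assoc]
  · change UniversalEnvelopingAlgebra.ι ℂ x • (t • m) = t • (UniversalEnvelopingAlgebra.ι ℂ x • m)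
    rw [algebra_compatible_smul (UniversalEnvelopingAlgebra ℂ g) t m,
      algebra_compatible_smul (UniversalEnvelopingAlgebra ℂ g) t
        (UniversalEnvelopingAlgebra.ι ℂ x • m), smul_smul, smul_smul, Algebra.commutes]

/-- The sum of all proper submodules. For the modules below this is the unique maximal proper
submodule. -/
def maxSubmodule (g M : Type*) [LieRing g] [LieAlgebra ℂ g] [AddCommGroup M] [Module ℂ M]
    [LieRingModule g M] [LieModule ℂ g M] : LieSubmodule ℂ g M :=
  sSup {N : LieSubmodule ℂ g M | N ≠ ⊤}

/-! ### Highest weight modules of `𝔤𝔩_S` -/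

/-- The left ideal of `U(𝔤𝔩_S)` generated by the `E_{m,n}` with `m < n` in `S` and by the
`E_{n,n} - λ_n` with `n ∈ S`. -/
def vermaIdeal (S : Finset ℤ) (lam : Weight) :
    Submodule (UniversalEnvelopingAlgebra ℂ (glS S)) (UniversalEnvelopingAlgebra ℂ (glS S)) :=
  Submodule.span _
    ({x | ∃ (m n : ℤ) (hm : m ∈ S) (hn : n ∈ S), m < n ∧
        x = UniversalEnvelopingAlgebra.ι ℂ (ES hm hn)} ∪
     {x | ∃ (n : ℤ) (hn : n ∈ S),
        x = UniversalEnvelopingAlgebra.ι ℂ (ES hn hn) - algebraMap ℂ _ (lam.val n)})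

/-- The Verma module `M(λ_S)` of `𝔤𝔩_S`. -/
def Verma (S : Finset ℤ) (lam : Weight) : Type :=
  UniversalEnvelopingAlgebra ℂ (glS S) ⧸ vermaIdeal S lam

instance (S : Finset ℤ) (lam : Weight) : AddCommGroup (Verma S lam) :=
  inferInstanceAs (AddCommGroup (_ ⧸ vermaIdeal S lam))
instance (S : Finset ℤ) (lam : Weight) : Module ℂ (Verma S lam) :=
  inferInstanceAs (Module ℂ (_ ⧸ vermaIdeal S lam))
instance (S : Finset ℤ) (lam : Weight) :
    Module (UniversalEnvelopingAlgebra ℂ (glS S)) (Verma S lam) :=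
  inferInstanceAs (Module _ (_ ⧸ vermaIdeal S lam))
instance (S : Finset ℤ) (lam : Weight) :
    IsScalarTower ℂ (UniversalEnvelopingAlgebra ℂ (glS S)) (Verma S lam) :=
  inferInstanceAs (IsScalarTower ℂ _ (_ ⧸ vermaIdeal S lam))
instance (S : Finset ℤ) (lam : Weight) : LieRingModule (glS S) (Verma S lam) :=
  envLieRingModule _ _
instance (S : Finset ℤ) (lam : Weight) : LieModule ℂ (glS S) (Verma S lam) :=
  envLieModule _ _

/-- The irreducible quotient `L(λ_S)` of the Verma module `M(λ_S)` of `𝔤𝔩_S`. -/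
def LFin (S : Finset ℤ) (lam : Weight) : Type :=
  Verma S lam ⧸ maxSubmodule (glS S) (Verma S lam)

instance (S : Finset ℤ) (lam : Weight) : AddCommGroup (LFin S lam) :=
  inferInstanceAs (AddCommGroup (_ ⧸ maxSubmodule (glS S) (Verma S lam)))
instance (S : Finset ℤ) (lam : Weight) : Module ℂ (LFin S lam) :=
  inferInstanceAs (Module ℂ (_ ⧸ maxSubmodule (glS S) (Verma S lam)))
instance (S : Finset ℤ) (lam : Weight) : LieRingModule (glS S) (LFin S lam) :=
  inferInstanceAs (LieRingModule (glS S) (_ ⧸ maxSubmodule (glS S) (Verma S lam)))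
instance (S : Finset ℤ) (lam : Weight) : LieModule ℂ (glS S) (LFin S lam) :=
  inferInstanceAs (LieModule ℂ (glS S) (_ ⧸ maxSubmodule (glS S) (Verma S lam)))

/-! ### Generalized Verma modules of `𝔤𝔩_∞` -/

section GenVerma

variable (S : Finset ℤ) (V : Type) [AddCommGroup V] [Module ℂ V] [LieRingModule (glS S) V]
  [LieModule ℂ (glS S) V]

/-- The kernel of `U(𝔤𝔩_∞) ⊗_ℂ V → U(𝔤𝔩_∞) ⊗_{U(𝔭)} V`, where
`𝔭 = 𝔤𝔩_S + span {E_{m,n} | n ∉ S}` and the second summand acts on `V` as zero: the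
`U(𝔤𝔩_∞)`-submodule generated by the `a ⊗ v - 1 ⊗ a v` for `a` in `𝔤𝔩_S`, and by the
`E_{m,n} ⊗ v` for `n ∉ S`. -/
def genVermaRel :
    Submodule (UniversalEnvelopingAlgebra ℂ gl) (UniversalEnvelopingAlgebra ℂ gl ⊗[ℂ] V) :=
  Submodule.span _
    ({t | ∃ (a : glS S) (v : V),
        t = UniversalEnvelopingAlgebra.ι ℂ (a : gl) ⊗ₜ[ℂ] v - 1 ⊗ₜ[ℂ] ⁅a, v⁆} ∪
     {t | ∃ (m n : ℤ) (v : V), n ∉ S ∧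
        t = UniversalEnvelopingAlgebra.ι ℂ (E m n) ⊗ₜ[ℂ] v})

/-- The generalized Verma module `M(S, V)` of `𝔤𝔩_∞`, induced from the `𝔤𝔩_S`-module `V`. -/
def GenVerma : Type :=
  (UniversalEnvelopingAlgebra ℂ gl ⊗[ℂ] V) ⧸ genVermaRel S V

instance : AddCommGroup (GenVerma S V) :=
  inferInstanceAs (AddCommGroup (_ ⧸ genVermaRel S V))
instance : Module ℂ (GenVerma S V) :=
  inferInstanceAs (Module ℂ (_ ⧸ genVermaRel S V))
instance : Module (UniversalEnvelopingAlgebra ℂ gl) (GenVerma S V) :=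
  inferInstanceAs (Module _ (_ ⧸ genVermaRel S V))
instance : IsScalarTower ℂ (UniversalEnvelopingAlgebra ℂ gl) (GenVerma S V) :=
  inferInstanceAs (IsScalarTower ℂ _ (_ ⧸ genVermaRel S V))
instance : LieRingModule gl (GenVerma S V) := envLieRingModule _ _
instance : LieModule ℂ gl (GenVerma S V) := envLieModule _ _

end GenVerma

/-- The `𝔤𝔩_∞`-module `L(S, λ)`: the irreducible quotient of the generalized Verma module
`M(S, L(λ_S))`. -/
def LInf (S : Finset ℤ) (lam : Weight) : Type :=
  GenVerma S (LFin S lam) ⧸ maxSubmodule gl (GenVerma S (LFin S lam))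

instance (S : Finset ℤ) (lam : Weight) : AddCommGroup (LInf S lam) :=
  inferInstanceAs (AddCommGroup (_ ⧸ maxSubmodule gl (GenVerma S (LFin S lam))))
instance (S : Finset ℤ) (lam : Weight) : Module ℂ (LInf S lam) :=
  inferInstanceAs (Module ℂ (_ ⧸ maxSubmodule gl (GenVerma S (LFin S lam))))
instance (S : Finset ℤ) (lam : Weight) : LieRingModule gl (LInf S lam) :=
  inferInstanceAs (LieRingModule gl (_ ⧸ maxSubmodule gl (GenVerma S (LFin S lam))))
instance (S : Finset ℤ) (lam : Weight) : LieModule ℂ gl (LInf S lam) :=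
  inferInstanceAs (LieModule ℂ gl (_ ⧸ maxSubmodule gl (GenVerma S (LFin S lam))))

/-! ### Cyclic modules and decompositions -/

/-- A module is cyclic if some single vector generates it. -/
def IsCyclicModule (g M : Type*) [LieRing g] [LieAlgebra ℂ g] [AddCommGroup M] [Module ℂ M]
    [LieRingModule g M] [LieModule ℂ g M] : Prop :=
  ∃ w : M, LieSubmodule.lieSpan ℂ g {w} = ⊤

/-- `L(S, λ) ⊗ L(S, μ)` is isomorphic to the direct sum of the `L(T, ν_i)` over `𝔤𝔩_∞`. -/
def InfDecomp (S T : Finset ℤ) (lam mu : Weight) {I : Type} (nu : I → Weight) : Prop :=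
  Nonempty (LInf S lam ⊗[ℂ] LInf S mu ≃ₗ⁅ℂ, gl⁆ ⨁ i, LInf T (nu i))

/-- `L(λ_T) ⊗ L(μ_T)` is isomorphic to the direct sum of the `L((ν_i)_T)` over `𝔤𝔩_T`. -/
def FinDecomp (T : Finset ℤ) (lam mu : Weight) {I : Type} (nu : I → Weight) : Prop :=
  Nonempty (LFin T lam ⊗[ℂ] LFin T mu ≃ₗ⁅ℂ, glS T⁆ ⨁ i, LFin T (nu i))

end GlInfty

end

/-!
Let `gl` act on the polynomial ring `Pol J` in the variables `x_{m,j}`, `m ∈ ℤ`, `j ∈ J`, by the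
derivations `E_{m,n} ↦ ∑_j x_{m,j} ∂/∂x_{n,j}`. The Fock form is positive definite there and makes
`E_{n,m}` the adjoint of `E_{m,n}`, so every submodule has an invariant complement. A product of
leading minors is a highest weight vector of weight `λ`, so `L(S, λ)` embeds in some `Pol J`, and
with it tensor products and direct sums of such modules. On these modules, taking the vectors killed
by all `E_{m,n}` with `n ∉ T` sends `L(S, λ)` to `L(λ_T)`, commutes with tensor products, and, as
soon as `#T` is at least the degree, loses nothing: every submodule is generated by such vectors.
Hence decompositions over `gl` and over `gl_T` correspond. A cyclic vector of the tensor product is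
`v ⊗ w` with `v` and `w` supported on disjoint sets of indices.
-/

noncomputable section

namespace GlInfty

attribute [local instance] LieRing.ofAssociativeRing LieAlgebra.ofAssociativeAlgebra

section LieModule

variable {R L M : Type*} [CommRing R] [LieRing L] [LieAlgebra R L] [AddCommGroup M] [Module R M]
  [LieRingModule L M] [LieModule R L M]

theorem lie_mem_of_span_eq_top {X : Set L} (hX : Submodule.span R X = ⊤) {W : Submodule R M}
    {w : M} (h : ∀ x ∈ X, ⁅x, w⁆ ∈ W) (x : L) : ⁅x, w⁆ ∈ W := by
  have hle : Submodule.span R X ≤ W.comap ((LieModule.toEnd R L M : L →ₗ[R] M →ₗ[R] M).flip w) :=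
    Submodule.span_le.2 h
  exact hle (hX ▸ Submodule.mem_top)

theorem lieSpan_toSubmodule_le {X Y : Set L} (hXY : Submodule.span R (X ∪ Y) = ⊤)
    {V W : Submodule R M} (hVW : V ≤ W) (hV : ∀ y ∈ Y, ∀ v ∈ V, ⁅y, v⁆ ∈ V)
    (hW : ∀ x ∈ X, ∀ w ∈ W, ⁅x, w⁆ ∈ W) :
    (LieSubmodule.lieSpan R L (V : Set M)).toSubmodule ≤ W := by
  set A : Set (Submodule R M) := {U | V ≤ U ∧ ∀ x ∈ X, ∀ u ∈ U, ⁅x, u⁆ ∈ U}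
  -- The smallest `X`-stable subspace `U ⊇ V` is also `Y`-stable: the `u` with `⁅y, u⁆ ∈ U` for
  -- all `y` form an `X`-stable subspace containing `V`.
  set U := sInf A
  have hVU : V ≤ U := le_sInf fun _ h => h.1
  have hXU : ∀ x ∈ X, ∀ u ∈ U, ⁅x, u⁆ ∈ U := fun x hx u hu =>
    Submodule.mem_sInf.2 fun N hN => hN.2 x hx u (Submodule.mem_sInf.1 hu N hN)
  let Q : Submodule R M :=
    { carrier := {u | u ∈ U ∧ ∀ y : L, ⁅y, u⁆ ∈ U}
      add_mem' := fun hu hv => ⟨add_mem hu.1 hv.1, fun y => by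
        rw [lie_add]; exact add_mem (hu.2 y) (hv.2 y)⟩
      zero_mem' := ⟨zero_mem _, fun y => by rw [lie_zero]; exact zero_mem _⟩
      smul_mem' := fun t u hu => ⟨U.smul_mem t hu.1, fun y => by
        rw [lie_smul]; exact U.smul_mem t (hu.2 y)⟩ }
  have hQ : Q ∈ A := by
    refine ⟨fun v hv => ⟨hVU hv, lie_mem_of_span_eq_top hXY ?_⟩, fun x hx u hu => ⟨hu.2 x, ?_⟩⟩
    · rintro y (hy | hy)
      · exact hXU y hy v (hVU hv)
      · exact hVU (hV y hy v hv)
    · intro y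
      rw [leibniz_lie]
      exact add_mem (hu.2 _) (hXU x hx _ (hu.2 y))
  let N : LieSubmodule R L M := { U with lie_mem := fun {y u} hu => ((sInf_le hQ : U ≤ Q) hu).2 y }
  have hN : LieSubmodule.lieSpan R L (V : Set M) ≤ N := LieSubmodule.lieSpan_le.2 hVU
  exact (show _ ≤ U from hN).trans (sInf_le ⟨hVW, hW⟩)

end LieModule

section HighestWeight

variable {L M M' : Type*} [LieRing L] [LieAlgebra ℂ L] [AddCommGroup M] [Module ℂ M]
  [LieRingModule L M] [LieModule ℂ L M] [AddCommGroup M'] [Module ℂ M'] [LieRingModule L M']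
  [LieModule ℂ L M'] {h : L} {a b : ℂ} {v : M}

/-- `v` is a highest weight vector, of degree `a` with respect to the grading of `L` by the
eigenvalues of `ad h`: it is an eigenvector of a subalgebra that spans `L` together with the part
of negative degree. Degrees are compared through their real parts. -/
structure IsHighest (h : L) (a : ℂ) (v : M) : Prop where
  lie_eq : ⁅h, v⁆ = a • v
  span_eq : Submodule.span ℂ ({x : L | ∃ d : ℂ, d.re < 0 ∧ ⁅h, x⁆ = d • x} ∪
    {x | ∃ t : ℂ, ⁅x, v⁆ = t • v}) = ⊤

omit [LieModule ℂ L M] [LieModule ℂ L M'] in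
theorem IsHighest.map (hv : IsHighest h a v) (f : M →ₗ⁅ℂ,L⁆ M') : IsHighest h a (f v) where
  lie_eq := by rw [← LieModuleHom.map_lie, hv.lie_eq, map_smul]
  span_eq := by
    refine top_le_iff.1 (hv.span_eq.ge.trans (Submodule.span_mono ?_))
    refine Set.union_subset_union_right _ ?_
    rintro x ⟨t, ht⟩
    exact ⟨t, by rw [← LieModuleHom.map_lie, ht, map_smul]⟩

/-- The sum of the eigenspaces of `h` of degree lower than `a`, in the sense of `IsHighest`. -/
def lowerPart (M : Type*) [AddCommGroup M] [Module ℂ M] [LieRingModule L M] [LieModule ℂ L M]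
    (h : L) (a : ℂ) : Submodule ℂ M :=
  ⨆ b : {b : ℂ // b.re < a.re}, (LieModule.toEnd ℂ L M h).eigenspace b

theorem mem_lowerPart_of_lie_eq {x : M} (hb : b.re < a.re) (hx : ⁅h, x⁆ = b • x) :
    x ∈ lowerPart M h a :=
  Submodule.mem_iSup_of_mem (p := fun b : {b : ℂ // b.re < a.re} =>
    (LieModule.toEnd ℂ L M h).eigenspace (b : ℂ)) ⟨b, hb⟩ (Module.End.mem_eigenspace_iff.2 hx)

theorem lowerPart_le {W : Submodule ℂ M}
    (hW : ∀ (b : ℂ) (x : M), b.re < a.re → ⁅h, x⁆ = b • x → x ∈ W) : lowerPart M h a ≤ W :=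
  iSup_le fun b x hx => hW b x b.2 (Module.End.mem_eigenspace_iff.1 hx)

theorem map_mem_lowerPart (f : M →ₗ⁅ℂ,L⁆ M') {x : M} (hx : x ∈ lowerPart M h a) :
    f x ∈ lowerPart M' h a := by
  refine (lowerPart_le (W := (lowerPart M' h a).comap (f : M →ₗ[ℂ] M')) ?_) hx
  intro b x hb hx
  exact mem_lowerPart_of_lie_eq (x := f x) hb (by rw [← LieModuleHom.map_lie, hx, map_smul])

theorem eq_zero_of_mem_lowerPart {x : M} (hx : x ∈ lowerPart M h a) (hx' : ⁅h, x⁆ = a • x) :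
    x = 0 := by
  have hd := Module.End.eigenspaces_iSupIndep (LieModule.toEnd ℂ L M h) a
  refine Submodule.disjoint_def.1 hd x (Module.End.mem_eigenspace_iff.2 hx') ?_
  refine (iSup_le fun b => ?_ : lowerPart M h a ≤ _) hx
  exact le_iSup₂_of_le (b : ℂ) (fun hb => b.2.ne (congrArg Complex.re hb)) le_rfl

theorem lie_mem_lowerPart {x : L} {d : ℂ} (hd : d.re < 0) (hx : ⁅h, x⁆ = d • x) {w : M}
    (hw : w ∈ lowerPart M h a) : ⁅x, w⁆ ∈ lowerPart M h a := by
  refine (lowerPart_le (W := (lowerPart M h a).comap (LieModule.toEnd ℂ L M x)) ?_) hw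
  intro b y hb hy
  refine mem_lowerPart_of_lie_eq (b := d + b) (by rw [Complex.add_re]; linarith) ?_
  rw [LieModule.toEnd_apply_apply, leibniz_lie, hx, hy, smul_lie, lie_smul, add_smul]

theorem IsHighest.lieSpan_le (hv : IsHighest h a v) :
    (LieSubmodule.lieSpan ℂ L {v}).toSubmodule ≤ (ℂ ∙ v) ⊔ lowerPart M h a := by
  refine le_trans (LieSubmodule.lieSpan_mono (Set.singleton_subset_iff.2
    (Submodule.mem_span_singleton_self v))) (lieSpan_toSubmodule_le hv.span_eq le_sup_left ?_ ?_)
  · rintro y ⟨t, ht⟩ w hw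
    obtain ⟨s, rfl⟩ := Submodule.mem_span_singleton.1 hw
    rw [lie_smul, ht]
    exact Submodule.smul_mem _ _ (Submodule.smul_mem _ _ (Submodule.mem_span_singleton_self v))
  · rintro x ⟨d, hd, hx⟩ w hw
    obtain ⟨y, hy, z, hz, rfl⟩ := Submodule.mem_sup.1 hw
    obtain ⟨s, rfl⟩ := Submodule.mem_span_singleton.1 hy
    rw [lie_add, lie_smul]
    refine Submodule.mem_sup_right (add_mem (Submodule.smul_mem _ _ ?_)
      (lie_mem_lowerPart hd hx hz))
    refine mem_lowerPart_of_lie_eq (b := d + a) (by rw [Complex.add_re]; linarith) ?_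
    rw [leibniz_lie, hx, hv.lie_eq, smul_lie, lie_smul, add_smul]

theorem mem_of_add_mem_of_mem_lowerPart {p : M} (hv : ⁅h, v⁆ = a • v) (hp : p ∈ lowerPart M h a)
    {N : LieSubmodule ℂ L M} (hN : v + p ∈ N) : v ∈ N := by
  let π := LieSubmodule.Quotient.mk' N
  have hπ : π v = -π p := by
    rw [eq_neg_iff_add_eq_zero, ← map_add]
    exact (LieSubmodule.Quotient.mk_eq_zero _).2 hN
  have hlow : π v ∈ lowerPart (M ⧸ N) h a := hπ ▸ neg_mem (map_mem_lowerPart π hp)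
  exact (LieSubmodule.Quotient.mk_eq_zero _).1 (eq_zero_of_mem_lowerPart hlow
    (by rw [← LieModuleHom.map_lie, hv, map_smul]))

theorem IsHighest.le_lowerPart (hv : IsHighest h a v) (hgen : LieSubmodule.lieSpan ℂ L {v} = ⊤)
    {N : LieSubmodule ℂ L M} (hN : N ≠ ⊤) : N.toSubmodule ≤ lowerPart M h a := by
  intro x hx
  obtain ⟨y, hy, p, hp, rfl⟩ :=
    Submodule.mem_sup.1 (hv.lieSpan_le (hgen ▸ LieSubmodule.mem_top x))
  obtain ⟨t, rfl⟩ := Submodule.mem_span_singleton.1 hy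
  have htv : t • v ∈ N :=
    mem_of_add_mem_of_mem_lowerPart (by rw [lie_smul, hv.lie_eq, smul_comm]) hp hx
  obtain rfl : t = 0 := by
    by_contra ht
    have hvN : v ∈ N := (N.toSubmodule.smul_mem_iff ht).1 htv
    exact hN (top_le_iff.1 (hgen ▸ LieSubmodule.lieSpan_le.2 (Set.singleton_subset_iff.2 hvN)))
  rwa [zero_smul, zero_add]

theorem IsHighest.maxSubmodule_le (hv : IsHighest h a v)
    (hgen : LieSubmodule.lieSpan ℂ L {v} = ⊤) :
    (maxSubmodule L M).toSubmodule ≤ lowerPart M h a := by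
  rw [maxSubmodule, LieSubmodule.sSup_toSubmodule]
  refine sSup_le ?_
  rintro _ ⟨N, hN, rfl⟩
  exact hv.le_lowerPart hgen hN

theorem IsHighest.notMem_maxSubmodule (hv : IsHighest h a v)
    (hgen : LieSubmodule.lieSpan ℂ L {v} = ⊤) (h0 : v ≠ 0) : v ∉ maxSubmodule L M :=
  fun hmem => h0 (eq_zero_of_mem_lowerPart (hv.maxSubmodule_le hgen hmem) hv.lie_eq)

theorem isIrreducible_quotient_maxSubmodule (h : maxSubmodule L M ≠ ⊤) :
    LieModule.IsIrreducible ℂ L (M ⧸ maxSubmodule L M) := by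
  let π := LieSubmodule.Quotient.mk' (maxSubmodule L M)
  have : Nontrivial (M ⧸ maxSubmodule L M) :=
    Submodule.Quotient.nontrivial_iff.2 (mt (LieSubmodule.toSubmodule_eq_top _).1 h)
  refine LieModule.IsIrreducible.mk fun N hN => ?_
  by_contra hT
  have hle : N.comap π ≤ maxSubmodule L M := le_sSup fun hc => hT (eq_top_iff.2 fun z _ => by
    obtain ⟨w, rfl⟩ := LieSubmodule.Quotient.surjective_mk' _ z
    exact LieSubmodule.mem_comap.1 (hc ▸ LieSubmodule.mem_top w : w ∈ N.comap π))
  refine hN (eq_bot_iff.2 fun x hx => ?_)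
  obtain ⟨y, rfl⟩ := LieSubmodule.Quotient.surjective_mk' _ x
  exact (LieSubmodule.mem_bot _).2 ((LieSubmodule.Quotient.mk_eq_zero _).2 (hle hx))

end HighestWeight

/-- A family of elements of a Lie algebra that spans it and multiplies like matrix units. It covers
both `𝔤𝔩_∞` and the `𝔤𝔩_T`. -/
structure IsGlFamily {ι L : Type*} [DecidableEq ι] [LieRing L] [LieAlgebra ℂ L]
    (e : ι → ι → L) : Prop where
  span_eq : Submodule.span ℂ {x | ∃ m n, x = e m n} = ⊤
  lie_eq : ∀ m n r s,
    ⁅e m n, e r s⁆ = (if n = r then e m s else 0) - (if m = s then e r n else 0)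

/-- A positive definite Hermitian form for which `e m n` and `e n m` are adjoint. -/
structure ContraForm {ι L : Type*} [LieRing L] (e : ι → ι → L) (M : Type*) [AddCommGroup M]
    [Module ℂ M] [LieRingModule L M] where
  /-- The underlying sesquilinear form. -/
  form : M →ₗ⋆[ℂ] M →ₗ[ℂ] ℂ
  contra : ∀ m n x y, form ⁅e m n, x⁆ y = form x ⁅e n m, y⁆
  pos : ∀ x, x ≠ 0 → 0 < (form x x).re

/-- The combination of the diagonal matrix units with coefficients `c`; it grades the Lie algebra,
with `e m n` in degree `c m - c n`. -/
def degreeElement {ι L : Type*} [LieRing L] [LieAlgebra ℂ L] (e : ι → ι → L) (s : Finset ι)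
    (c : ι → ℕ) : L :=
  ∑ i ∈ s, (c i : ℂ) • e i i

section GlFamily

variable {ι L M M' : Type*} [LieRing L] [LieAlgebra ℂ L] {e : ι → ι → L} [AddCommGroup M]
  [Module ℂ M] [LieRingModule L M] [LieModule ℂ L M] [AddCommGroup M'] [Module ℂ M']
  [LieRingModule L M'] [LieModule ℂ L M']

section IsGlFamily

variable [DecidableEq ι]

theorem IsGlFamily.lie_mem (he : IsGlFamily e) {W : Submodule ℂ M} {w : M}
    (h : ∀ m n, ⁅e m n, w⁆ ∈ W) (x : L) : ⁅x, w⁆ ∈ W := by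
  refine lie_mem_of_span_eq_top he.span_eq ?_ x
  rintro _ ⟨m, n, rfl⟩
  exact h m n

/-- A subspace stable under the matrix units, as a Lie submodule. -/
def IsGlFamily.toLieSubmodule (he : IsGlFamily e) (W : Submodule ℂ M)
    (h : ∀ m n, ∀ w ∈ W, ⁅e m n, w⁆ ∈ W) : LieSubmodule ℂ L M where
  toSubmodule := W
  lie_mem {x w} hw := he.lie_mem (fun m n => h m n w hw) x

theorem IsGlFamily.degreeElement_lie (he : IsGlFamily e) {s : Finset ι} {c : ι → ℕ}
    (hc : ∀ i, i ∉ s → c i = 0) (m n : ι) :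
    ⁅degreeElement e s c, e m n⁆ = ((c m : ℂ) - c n) • e m n := by
  have hterm (i : ι) : (c i : ℂ) • ⁅e i i, e m n⁆ =
      (if i = m then (c i : ℂ) • e m n else 0) - (if i = n then (c i : ℂ) • e m n else 0) := by
    rw [he.lie_eq, smul_sub]
    congr 1 <;> split_ifs with h <;> simp [h]
  have hsum (j : ι) : (∑ i ∈ s, if i = j then (c i : ℂ) • e m n else 0) = (c j : ℂ) • e m n := by
    rw [Finset.sum_ite_eq']
    split_ifs with h
    · rfl
    · simp [hc j h]
  rw [degreeElement, sum_lie]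
  simp only [smul_lie, hterm, Finset.sum_sub_distrib, hsum, sub_smul]

theorem IsGlFamily.isHighest (he : IsGlFamily e) {s : Finset ι} {c : ι → ℕ}
    (hc : ∀ i, i ∉ s → c i = 0) {l : ι → ℂ} {v : M} (hl : ∀ i ∈ s, ⁅e i i, v⁆ = l i • v)
    (hv : ∀ m n, c n ≤ c m → ∃ t : ℂ, ⁅e m n, v⁆ = t • v) :
    IsHighest (degreeElement e s c) (∑ i ∈ s, (c i : ℂ) * l i) v where
  lie_eq := by
    rw [degreeElement, sum_lie, Finset.sum_smul]
    refine Finset.sum_congr rfl fun i hi => ?_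
    rw [smul_lie, hl i hi, mul_smul]
  span_eq := by
    refine top_le_iff.1 (he.span_eq.ge.trans (Submodule.span_mono ?_))
    rintro _ ⟨m, n, rfl⟩
    rcases lt_or_ge (c m) (c n) with h | h
    · refine Or.inl ⟨(c m : ℂ) - c n, ?_, he.degreeElement_lie hc m n⟩
      rw [Complex.sub_re, Complex.natCast_re, Complex.natCast_re]
      exact sub_neg.2 (Nat.cast_lt.2 h)
    · exact Or.inr (hv m n h)

end IsGlFamily

namespace ContraForm

variable (B : ContraForm e M)

omit [LieAlgebra ℂ L] [LieModule ℂ L M] in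
theorem eq_zero {x : M} (h : B.form x x = 0) : x = 0 := by
  by_contra h0
  simpa [h] using B.pos x h0

/-- The restriction of a form along an injective homomorphism. -/
def comap (B : ContraForm e M') (f : M →ₗ⁅ℂ,L⁆ M') (hf : Function.Injective f) :
    ContraForm e M where
  form := (B.form.comp (f : M →ₗ[ℂ] M')).compl₂ (f : M →ₗ[ℂ] M')
  contra m n x y := by
    change B.form (f ⁅e m n, x⁆) (f y) = B.form (f x) (f ⁅e n m, y⁆)
    rw [LieModuleHom.map_lie, LieModuleHom.map_lie, B.contra]
  pos x hx := B.pos (f x) fun h => hx (hf (h.trans (map_zero f).symm))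

theorem form_degreeElement_lie (s : Finset ι) (c : ι → ℕ) (x y : M) :
    B.form ⁅degreeElement e s c, x⁆ y = B.form x ⁅degreeElement e s c, y⁆ := by
  simp only [degreeElement, sum_lie, smul_lie, map_sum, LinearMap.sum_apply, map_smul,
    LinearMap.map_smulₛₗ, LinearMap.smul_apply, B.contra, Complex.conj_natCast]

/-- The orthogonal complement of a submodule. -/
def orthogonal [DecidableEq ι] (he : IsGlFamily e) (N : LieSubmodule ℂ L M) :
    LieSubmodule ℂ L M :=
  he.toLieSubmodule
    { carrier := {y | ∀ x ∈ N, B.form x y = 0}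
      add_mem' := fun {y z} hy hz x hx => by rw [map_add, hy x hx, hz x hx, add_zero]
      zero_mem' := fun x _ => map_zero _
      smul_mem' := fun t y hy x hx => by rw [map_smul, hy x hx, smul_zero] }
    fun m n y hy x hx => by rw [← B.contra]; exact hy _ (N.lie_mem hx)

theorem mem_orthogonal [DecidableEq ι] (he : IsGlFamily e) {N : LieSubmodule ℂ L M} {y : M} :
    y ∈ B.orthogonal he N ↔ ∀ x ∈ N, B.form x y = 0 := Iff.rfl

theorem form_eq_zero_of_mem_lowerPart {h : L} {a : ℂ}
    (hh : ∀ x y : M, B.form ⁅h, x⁆ y = B.form x ⁅h, y⁆) {x y : M}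
    (hx : x ∈ lowerPart M h a) (hy : ⁅h, y⁆ = a • y) : B.form x y = 0 := by
  refine (lowerPart_le (W := LinearMap.ker (B.form.flip y)) fun b x hb hx => ?_) hx
  have heq : (starRingEnd ℂ) b * B.form x y = a * B.form x y := by
    simpa only [hx, hy, LinearMap.map_smulₛₗ, LinearMap.smul_apply, map_smul, smul_eq_mul]
      using hh x y
  refine LinearMap.mem_ker.2 ((mul_eq_mul_right_iff.1 heq).resolve_left fun hba => hb.ne ?_)
  rw [← hba, Complex.conj_re]

end ContraForm

theorem IsHighest.ker_eq_maxSubmodule [DecidableEq ι] (he : IsGlFamily e) {h : L} {a : ℂ} {q : M}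
    (hq : IsHighest h a q) (hgen : LieSubmodule.lieSpan ℂ L {q} = ⊤) (B : ContraForm e M')
    (hh : ∀ x y : M', B.form ⁅h, x⁆ y = B.form x ⁅h, y⁆) (f : M →ₗ⁅ℂ,L⁆ M')
    (hf : f q ≠ 0) : f.ker = maxSubmodule L M := by
  refine le_antisymm (le_sSup fun hk => hf (LieModuleHom.mem_ker.1 (hk ▸ LieSubmodule.mem_top q)))
    fun x hx => ?_
  have hle : (⊤ : LieSubmodule ℂ L M) ≤ (B.orthogonal he ((maxSubmodule L M).map f)).comap f := by
    rw [← hgen, LieSubmodule.lieSpan_le, Set.singleton_subset_iff]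
    refine (B.mem_orthogonal he).2 fun y hy => ?_
    obtain ⟨z, hz, rfl⟩ := (LieSubmodule.mem_map _).1 hy
    exact B.form_eq_zero_of_mem_lowerPart hh
      (map_mem_lowerPart f (hq.maxSubmodule_le hgen hz)) (hq.map f).lie_eq
  exact LieModuleHom.mem_ker.2 (B.eq_zero
    (hle (LieSubmodule.mem_top x) (f x) (LieSubmodule.mem_map_of_mem hx)))

end GlFamily

section UniversalEnveloping

variable (g M : Type*) [LieRing g] [LieAlgebra ℂ g] [AddCommGroup M] [Module ℂ M]

variable {g} in
theorem adjoin_range_ι :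
    Algebra.adjoin ℂ (Set.range (UniversalEnvelopingAlgebra.ι ℂ (L := g))) = ⊤ := by
  set A := Algebra.adjoin ℂ (Set.range (UniversalEnvelopingAlgebra.ι ℂ (L := g)))
  let j : g →ₗ⁅ℂ⁆ A :=
    { toFun := fun x => ⟨UniversalEnvelopingAlgebra.ι ℂ x, Algebra.subset_adjoin ⟨x, rfl⟩⟩
      map_add' := fun x y => Subtype.ext (map_add _ x y)
      map_smul' := fun t x => Subtype.ext (map_smul _ t x)
      map_lie' := fun {x y} => Subtype.ext (LieHom.map_lie _ x y) }
  have hid : A.val.comp (UniversalEnvelopingAlgebra.lift ℂ j) = AlgHom.id ℂ _ := by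
    ext x
    exact congrArg Subtype.val (UniversalEnvelopingAlgebra.lift_ι_apply ℂ j x)
  refine eq_top_iff.2 fun x _ => ?_
  rw [← AlgHom.id_apply (R := ℂ) x, ← hid]
  exact (UniversalEnvelopingAlgebra.lift ℂ j x).2

variable {g M} in
theorem smul_mem_of_ι_smul_mem [Module (UniversalEnvelopingAlgebra ℂ g) M]
    [IsScalarTower ℂ (UniversalEnvelopingAlgebra ℂ g) M] {N : Submodule ℂ M}
    (hN : ∀ a, ∀ x ∈ N, UniversalEnvelopingAlgebra.ι ℂ (L := g) a • x ∈ N)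
    (u : UniversalEnvelopingAlgebra ℂ g) {x : M} (hx : x ∈ N) : u • x ∈ N := by
  have hu : u ∈ Algebra.adjoin ℂ (Set.range (UniversalEnvelopingAlgebra.ι ℂ (L := g))) :=
    adjoin_range_ι (g := g) ▸ Algebra.mem_top
  induction hu using Algebra.adjoin_induction generalizing x with
  | mem u h => obtain ⟨a, rfl⟩ := h; exact hN a x hx
  | algebraMap t => rw [algebraMap_smul]; exact N.smul_mem t hx
  | add u w _ _ hu hw => rw [add_smul]; exact add_mem (hu hx) (hw hx)
  | mul u w _ _ hu hw => rw [mul_smul]; exact hu (hw hx)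

variable [LieRingModule g M] [LieModule ℂ g M]

/-- A `g`-module as a module over the enveloping algebra, inverse to `envLieRingModule`. -/
@[reducible] def liftModule : Module (UniversalEnvelopingAlgebra ℂ g) M :=
  Module.compHom M
    (UniversalEnvelopingAlgebra.lift ℂ (LieModule.toEnd ℂ g M) :
      UniversalEnvelopingAlgebra ℂ g →+* Module.End ℂ M)

theorem liftModule_smul (u : UniversalEnvelopingAlgebra ℂ g) (x : M) :
    letI := liftModule g M
    u • x = UniversalEnvelopingAlgebra.lift ℂ (LieModule.toEnd ℂ g M) u x := rfl

theorem liftModule_isScalarTower :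
    letI := liftModule g M
    IsScalarTower ℂ (UniversalEnvelopingAlgebra ℂ g) M := by
  let _ := liftModule g M
  refine ⟨fun t u x => ?_⟩
  rw [liftModule_smul, liftModule_smul, map_smul, LinearMap.smul_apply]

theorem liftModule_ι_smul (a : g) (x : M) :
    letI := liftModule g M
    UniversalEnvelopingAlgebra.ι ℂ a • x = ⁅a, x⁆ := by
  let _ := liftModule g M
  rw [liftModule_smul, UniversalEnvelopingAlgebra.lift_ι_apply, LieModule.toEnd_apply_apply]

theorem liftModule_algebraMap_smul (a : ℂ) (x : M) :
    letI := liftModule g M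
    algebraMap ℂ (UniversalEnvelopingAlgebra ℂ g) a • x = a • x := by
  let _ := liftModule g M
  rw [liftModule_smul, AlgHom.commutes, Module.algebraMap_end_apply]

end UniversalEnveloping

section GeneratedByOneVector

variable {L Q M : Type*} [LieRing L] [LieAlgebra ℂ L] [AddCommGroup Q] [Module ℂ Q]
  [LieRingModule L Q] [LieModule ℂ L Q] [AddCommGroup M] [Module ℂ M] [LieRingModule L M]
  [LieModule ℂ L M]

omit [LieAlgebra ℂ L] [LieModule ℂ L Q] [LieModule ℂ L M] in
theorem map_mem_of_lieSpan_eq_top {q : Q} (hq : LieSubmodule.lieSpan ℂ L {q} = ⊤)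
    (f : Q →ₗ⁅ℂ,L⁆ M) {N : LieSubmodule ℂ L M} (h : f q ∈ N) (x : Q) : f x ∈ N := by
  have hle : LieSubmodule.lieSpan ℂ L {q} ≤ N.comap f :=
    LieSubmodule.lieSpan_le.2 (Set.singleton_subset_iff.2 h)
  exact hle (hq ▸ LieSubmodule.mem_top x)

theorem lieSpan_quotient_mk {q : Q} (hq : LieSubmodule.lieSpan ℂ L {q} = ⊤)
    (N : LieSubmodule ℂ L Q) : LieSubmodule.lieSpan ℂ L {LieSubmodule.Quotient.mk' N q} = ⊤ := by
  refine eq_top_iff.2 fun x _ => ?_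
  obtain ⟨x, rfl⟩ := LieSubmodule.Quotient.surjective_mk' N x
  exact map_mem_of_lieSpan_eq_top hq (LieSubmodule.Quotient.mk' N)
    (N := LieSubmodule.lieSpan ℂ L {LieSubmodule.Quotient.mk' N q})
    (LieSubmodule.subset_lieSpan (Set.mem_singleton _)) x

omit [LieModule ℂ L M] in
theorem exists_injective_quotient_hom (f : Q →ₗ⁅ℂ,L⁆ M) {N : LieSubmodule ℂ L Q}
    (hN : f.ker = N) :
    ∃ F : (Q ⧸ N) →ₗ⁅ℂ,L⁆ M, Function.Injective F ∧
      ∀ x, F (LieSubmodule.Quotient.mk' N x) = f x := by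
  have hle : N.toSubmodule ≤ LinearMap.ker (f : Q →ₗ[ℂ] M) := fun x hx =>
    LieModuleHom.mem_ker.1 (hN ▸ hx : x ∈ f.ker)
  let ψ : (Q ⧸ N) →ₗ[ℂ] M := N.toSubmodule.liftQ (f : Q →ₗ[ℂ] M) hle
  have hψ (x : Q) : ψ (LieSubmodule.Quotient.mk' N x) = f x := rfl
  refine ⟨{ ψ with map_lie' := fun {a x} => ?_ }, ?_, hψ⟩
  · obtain ⟨x, rfl⟩ := LieSubmodule.Quotient.surjective_mk' N x
    change ψ ⁅a, LieSubmodule.Quotient.mk' N x⁆ = ⁅a, ψ (LieSubmodule.Quotient.mk' N x)⁆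
    rw [← LieModuleHom.map_lie, hψ, hψ, LieModuleHom.map_lie]
  · refine (injective_iff_map_eq_zero ψ).2 fun x hx => ?_
    obtain ⟨x, rfl⟩ := LieSubmodule.Quotient.surjective_mk' N x
    exact (LieSubmodule.Quotient.mk_eq_zero N).2 (hN ▸ LieModuleHom.mem_ker.2 hx)

end GeneratedByOneVector

section MatrixUnits

theorem span_subtype_eq_top {R L : Type*} [CommRing R] [LieRing L] [LieAlgebra R L]
    (A : LieSubalgebra R L) {s : Set L} (hs : A.toSubmodule = Submodule.span R s) :
    Submodule.span R {x : A | (x : L) ∈ s} = ⊤ := by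
  have hsA : s ⊆ A := fun x hx => hs.ge (Submodule.subset_span hx)
  refine Submodule.map_injective_of_injective A.toSubmodule.injective_subtype ?_
  have himage : A.toSubmodule.subtype '' {x : A | (x : L) ∈ s} = s := Set.ext fun x =>
    ⟨fun ⟨_, hy, hyx⟩ => hyx ▸ hy, fun hx => ⟨⟨x, hsA hx⟩, hx, rfl⟩⟩
  refine (Submodule.map_span _ _).trans ?_
  rw [himage, Submodule.map_top, Submodule.range_subtype, ← hs]

theorem isGlFamily_E : IsGlFamily E where
  span_eq := by
    rw [← span_subtype_eq_top gl (s := {x | ∃ m n : ℤ, x = unit m n}) rfl]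
    congr 1
    ext x
    exact exists_congr fun m => exists_congr fun n => Subtype.ext_iff
  lie_eq := E_lie

/-- The matrix units of `𝔤𝔩_S`, indexed by `S`. -/
def EFin (S : Finset ℤ) (m n : S) : glS S := ES m.2 n.2

theorem coe_EFin {S : Finset ℤ} (m n : S) : (EFin S m n : gl) = E m n := rfl

theorem isGlFamily_EFin (S : Finset ℤ) : IsGlFamily (EFin S) where
  span_eq := by
    rw [← span_subtype_eq_top (glS S) (s := {x | ∃ m ∈ S, ∃ n ∈ S, x = E m n}) rfl]
    congr 1
    ext x
    constructor
    · rintro ⟨m, n, rfl⟩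
      exact ⟨m, m.2, n, n.2, rfl⟩
    · rintro ⟨m, hm, n, hn, hx⟩
      exact ⟨⟨m, hm⟩, ⟨n, hn⟩, Subtype.ext hx⟩
  lie_eq m n r s := by
    apply Subtype.ext
    have h := E_lie m n r s
    simp only [← Subtype.ext_iff] at h
    rw [LieSubalgebra.coe_bracket, coe_EFin, coe_EFin, h]
    split_ifs <;> simp [coe_EFin]

/-- A form contravariant for `𝔤𝔩_∞` is contravariant for `𝔤𝔩_S`. -/
def ContraForm.toFin {M : Type*} [AddCommGroup M] [Module ℂ M] [LieRingModule gl M]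
    (B : ContraForm E M) (S : Finset ℤ) : ContraForm (EFin S) M where
  form := B.form
  contra m n := B.contra m n
  pos := B.pos

variable {M : Type*} [AddCommGroup M] [Module ℂ M] [LieRingModule gl M] [LieModule ℂ gl M]

/-- The vectors of a `𝔤𝔩_∞`-module killed by all `E_{m,n}` with `n ∉ T`. In `L(T, ν)` this is the
copy of `L(ν_T)` from which `L(T, ν)` is induced. -/
def supportedIn (M : Type*) [AddCommGroup M] [Module ℂ M] [LieRingModule gl M] [LieModule ℂ gl M]
    (T : Set ℤ) : Submodule ℂ M where
  carrier := {x | ∀ m n, n ∉ T → ⁅E m n, x⁆ = 0}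
  add_mem' {x y} hx hy m n hn := by rw [lie_add, hx m n hn, hy m n hn, add_zero]
  zero_mem' m n _ := lie_zero _
  smul_mem' t x hx m n hn := by rw [lie_smul, hx m n hn, smul_zero]

theorem lie_mem_supportedIn {T : Set ℤ} {x : M} (hx : x ∈ supportedIn M T) {a : ℤ} (ha : a ∈ T)
    (b : ℤ) : ⁅E a b, x⁆ ∈ supportedIn M T := by
  intro m n hn
  have hna : n ≠ a := fun h => hn (h ▸ ha)
  rw [leibniz_lie, hx m n hn, lie_zero, add_zero, E_lie, if_neg hna, zero_sub, neg_lie]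
  split_ifs with h
  · rw [hx _ _ hn, neg_zero]
  · rw [zero_lie, neg_zero]

/-- `supportedIn M T` as a `𝔤𝔩_T`-module. -/
def supportedFin (M : Type*) [AddCommGroup M] [Module ℂ M] [LieRingModule gl M] [LieModule ℂ gl M]
    (T : Finset ℤ) : LieSubmodule ℂ (glS T) M :=
  (isGlFamily_EFin T).toLieSubmodule (supportedIn M T)
    fun a b _ hx => lie_mem_supportedIn hx a.2 b

end MatrixUnits

section HighestWeightVectors

variable {S : Finset ℤ} {lam : Weight}

/-- `v` is a vector of weight `λ_S` killed by the raising operators of `𝔤𝔩_S`. -/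
structure IsHWFin (S : Finset ℤ) (lam : Weight) {X : Type*} [AddCommGroup X] [Module ℂ X]
    [LieRingModule (glS S) X] (v : X) : Prop where
  raise : ∀ m n : S, m < n → ⁅EFin S m n, v⁆ = 0
  weight : ∀ n : S, ⁅EFin S n n, v⁆ = lam.val n • v

/-- `v` is a highest weight vector for `𝔤𝔩_S` on which the `E_{m,n}` with `n ∉ S` act as zero, like
the generator of `L(S, λ)`. -/
structure IsHWInf (S : Finset ℤ) (lam : Weight) {M : Type*} [AddCommGroup M] [Module ℂ M]
    [LieRingModule gl M] (v : M) : Prop extends IsHWFin S lam v where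
  kill : ∀ m n, n ∉ S → ⁅E m n, v⁆ = 0

theorem IsHWFin.map {X Y : Type*} [AddCommGroup X] [Module ℂ X] [LieRingModule (glS S) X]
    [AddCommGroup Y] [Module ℂ Y] [LieRingModule (glS S) Y] {v : X} (hv : IsHWFin S lam v)
    (f : X →ₗ⁅ℂ,glS S⁆ Y) : IsHWFin S lam (f v) where
  raise m n h := by rw [← LieModuleHom.map_lie, hv.raise m n h, map_zero]
  weight n := by rw [← LieModuleHom.map_lie, hv.weight n, map_smul]

theorem IsHWInf.map {M N : Type*} [AddCommGroup M] [Module ℂ M] [LieRingModule gl M]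
    [AddCommGroup N] [Module ℂ N] [LieRingModule gl N] {v : M} (hv : IsHWInf S lam v)
    (f : M →ₗ⁅ℂ,gl⁆ N) : IsHWInf S lam (f v) where
  raise m n h := by
    change ⁅E m n, f v⁆ = 0
    rw [← LieModuleHom.map_lie]
    exact (congrArg f (hv.raise m n h)).trans (map_zero f)
  weight n := by
    change ⁅E n n, f v⁆ = _
    rw [← LieModuleHom.map_lie, ← map_smul]
    exact congrArg f (hv.weight n)
  kill m n h := by rw [← LieModuleHom.map_lie, hv.kill m n h, map_zero]

/-- The position of `i` in `S`, counted from above, and `0` outside `S`. The degree element with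
these coefficients makes every `E_{m,n}` with `n ∈ S` that is not in the parabolic subalgebra
lower the degree. -/
def depth (S : Finset ℤ) (i : ℤ) : ℕ := if i ∈ S then {j ∈ S | i ≤ j}.card else 0

theorem depth_pos {i : ℤ} (hi : i ∈ S) : 0 < depth S i := by
  rw [depth, if_pos hi]
  exact Finset.card_pos.2 ⟨i, Finset.mem_filter.2 ⟨hi, le_rfl⟩⟩

theorem depth_of_notMem {i : ℤ} (hi : i ∉ S) : depth S i = 0 := if_neg hi

theorem depth_lt_depth {i j : ℤ} (hi : i ∈ S) (hj : j ∈ S) (hij : i < j) :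
    depth S j < depth S i := by
  rw [depth, depth, if_pos hi, if_pos hj]
  refine Finset.card_lt_card (Finset.ssubset_iff_of_subset ?_ |>.2 ⟨i, ?_, ?_⟩)
  · exact fun k hk => Finset.mem_filter.2
      ⟨(Finset.mem_filter.1 hk).1, hij.le.trans (Finset.mem_filter.1 hk).2⟩
  · exact Finset.mem_filter.2 ⟨hi, le_rfl⟩
  · exact fun h => hij.not_ge (Finset.mem_filter.1 h).2

theorem le_of_depth_le {i j : ℤ} (hi : i ∈ S) (hj : j ∈ S) (h : depth S j ≤ depth S i) : i ≤ j :=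
  not_lt.1 fun hji => (depth_lt_depth hj hi hji).not_ge h

theorem IsHWFin.isHighest {X : Type*} [AddCommGroup X] [Module ℂ X] [LieRingModule (glS S) X]
    [LieModule ℂ (glS S) X] {v : X} (hv : IsHWFin S lam v) :
    IsHighest (degreeElement (EFin S) Finset.univ fun i => depth S i)
      (∑ i : S, (depth S i : ℂ) * lam.val i) v := by
  refine (isGlFamily_EFin S).isHighest (fun i hi => absurd (Finset.mem_univ i) hi)
    (fun i _ => hv.weight i) fun m n hmn => ?_
  rcases (show m ≤ n from le_of_depth_le m.2 n.2 hmn).eq_or_lt with rfl | h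
  · exact ⟨_, hv.weight m⟩
  · exact ⟨0, by rw [hv.raise m n h, zero_smul]⟩

theorem IsHWInf.isHighest {M : Type*} [AddCommGroup M] [Module ℂ M] [LieRingModule gl M]
    [LieModule ℂ gl M] {v : M} (hv : IsHWInf S lam v) :
    IsHighest (degreeElement E S (depth S)) (∑ i ∈ S, (depth S i : ℂ) * lam.val i) v := by
  refine isGlFamily_E.isHighest (fun i hi => depth_of_notMem hi)
    (fun i hi => hv.weight ⟨i, hi⟩) fun m n hmn => ?_
  by_cases hn : n ∈ S
  · have hm : m ∈ S := by
      by_contra hm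
      exact (depth_pos hn).not_ge (depth_of_notMem hm ▸ hmn)
    rcases (le_of_depth_le hm hn hmn).eq_or_lt with rfl | h
    · exact ⟨_, hv.weight ⟨m, hm⟩⟩
    · exact ⟨0, by rw [zero_smul]; exact hv.raise ⟨m, hm⟩ ⟨n, hn⟩ h⟩
  · exact ⟨0, by rw [hv.kill m n hn, zero_smul]⟩

end HighestWeightVectors

section Verma

variable (S : Finset ℤ) (lam : Weight)

/-- The highest weight vector `1` of the Verma module. -/
def vermaGen : Verma S lam := (vermaIdeal S lam).mkQ 1

theorem verma_lie (a : glS S) (x : Verma S lam) :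
    ⁅a, x⁆ = UniversalEnvelopingAlgebra.ι ℂ a • x := rfl

theorem smul_vermaGen (u : UniversalEnvelopingAlgebra ℂ (glS S)) :
    u • vermaGen S lam = (vermaIdeal S lam).mkQ u := by
  rw [vermaGen, ← mul_one u, ← smul_eq_mul, map_smul, smul_eq_mul, mul_one]
  rfl

theorem lieSpan_vermaGen : LieSubmodule.lieSpan ℂ (glS S) {vermaGen S lam} = ⊤ := by
  refine eq_top_iff.2 fun x _ => ?_
  obtain ⟨u, rfl⟩ := (vermaIdeal S lam).mkQ_surjective x
  rw [← smul_vermaGen]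
  exact smul_mem_of_ι_smul_mem
    (N := (LieSubmodule.lieSpan ℂ (glS S) {vermaGen S lam}).toSubmodule)
    (fun a x hx => LieSubmodule.lie_mem _ hx) u (LieSubmodule.subset_lieSpan rfl)

theorem isHWFin_vermaGen : IsHWFin S lam (vermaGen S lam) where
  raise m n hmn := by
    rw [verma_lie, smul_vermaGen]
    exact (Submodule.Quotient.mk_eq_zero _).2
      (Submodule.subset_span (Or.inl ⟨m, n, m.2, n.2, hmn, rfl⟩))
  weight n := by
    rw [verma_lie, ← algebraMap_smul (UniversalEnvelopingAlgebra ℂ (glS S)), smul_vermaGen,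
      smul_vermaGen]
    exact (Submodule.Quotient.eq _).2 (Submodule.subset_span (Or.inr ⟨n, n.2, rfl⟩))

variable {S lam}

theorem exists_verma_hom {X : Type*} [AddCommGroup X] [Module ℂ X] [LieRingModule (glS S) X]
    [LieModule ℂ (glS S) X] {v : X} (hv : IsHWFin S lam v) :
    ∃ f : Verma S lam →ₗ⁅ℂ,glS S⁆ X, f (vermaGen S lam) = v := by
  let _ := liftModule (glS S) X
  have _ := liftModule_isScalarTower (glS S) X
  let φ := LinearMap.toSpanSingleton (UniversalEnvelopingAlgebra ℂ (glS S)) X v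
  have hφ : vermaIdeal S lam ≤ LinearMap.ker φ := by
    rw [vermaIdeal, Submodule.span_le]
    rintro _ (⟨m, n, hm, hn, hmn, rfl⟩ | ⟨n, hn, rfl⟩)
    · change UniversalEnvelopingAlgebra.ι ℂ (ES hm hn) • v = 0
      rw [liftModule_ι_smul]
      exact hv.raise ⟨m, hm⟩ ⟨n, hn⟩ hmn
    · change (UniversalEnvelopingAlgebra.ι ℂ (ES hn hn) - algebraMap ℂ _ (lam.val n)) • v = 0
      rw [sub_smul, liftModule_ι_smul, liftModule_algebraMap_smul, sub_eq_zero]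
      exact hv.weight ⟨n, hn⟩
  let ψ : Verma S lam →ₗ[UniversalEnvelopingAlgebra ℂ (glS S)] X := (vermaIdeal S lam).liftQ φ hφ
  refine ⟨{ ψ.restrictScalars ℂ with map_lie' := fun {a x} => ?_ }, ?_⟩
  · change ψ ⁅a, x⁆ = ⁅a, ψ x⁆
    rw [verma_lie, map_smul, liftModule_ι_smul]
  · exact one_smul (UniversalEnvelopingAlgebra ℂ (glS S)) v

end Verma

section GenVerma

variable {S : Finset ℤ} {V : Type} [AddCommGroup V] [Module ℂ V] [LieRingModule (glS S) V]
  [LieModule ℂ (glS S) V]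

/-- The inclusion `x ↦ 1 ⊗ x` of `V` into the module induced from it. -/
def genVermaIncl (S : Finset ℤ) (V : Type) [AddCommGroup V] [Module ℂ V] [LieRingModule (glS S) V]
    [LieModule ℂ (glS S) V] : V →ₗ[ℂ] GenVerma S V where
  toFun x := (genVermaRel S V).mkQ (1 ⊗ₜ x)
  map_add' x y := by rw [TensorProduct.tmul_add, map_add]; rfl
  map_smul' t x := by rw [TensorProduct.tmul_smul]; rfl

omit [LieModule ℂ (glS S) V] in
theorem genVerma_lie (a : gl) (x : GenVerma S V) :
    ⁅a, x⁆ = UniversalEnvelopingAlgebra.ι ℂ a • x := rfl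

theorem smul_genVermaIncl (u : UniversalEnvelopingAlgebra ℂ gl) (x : V) :
    u • genVermaIncl S V x = (genVermaRel S V).mkQ (u ⊗ₜ x) := by
  change (genVermaRel S V).mkQ (u • (1 ⊗ₜ x)) = _
  rw [TensorProduct.smul_tmul', smul_eq_mul, mul_one]

theorem lie_genVermaIncl (a : glS S) (x : V) :
    ⁅a, genVermaIncl S V x⁆ = genVermaIncl S V ⁅a, x⁆ := by
  rw [LieSubalgebra.coe_bracket_of_module, genVerma_lie, smul_genVermaIncl]
  change _ = (genVermaRel S V).mkQ (1 ⊗ₜ ⁅a, x⁆)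
  rw [← sub_eq_zero, ← map_sub]
  exact (Submodule.Quotient.mk_eq_zero _).2 (Submodule.subset_span (Or.inl ⟨a, x, rfl⟩))

theorem lie_genVermaIncl_of_notMem {m n : ℤ} (hn : n ∉ S) (x : V) :
    ⁅E m n, genVermaIncl S V x⁆ = 0 := by
  rw [genVerma_lie, smul_genVermaIncl]
  exact (Submodule.Quotient.mk_eq_zero _).2 (Submodule.subset_span (Or.inr ⟨m, n, x, hn, rfl⟩))

theorem lieSpan_genVermaIncl {x : V} (hx : LieSubmodule.lieSpan ℂ (glS S) {x} = ⊤) :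
    LieSubmodule.lieSpan ℂ gl {genVermaIncl S V x} = ⊤ := by
  let incl : V →ₗ⁅ℂ,glS S⁆ GenVerma S V :=
    { genVermaIncl S V with map_lie' := fun {a y} => (lie_genVermaIncl a y).symm }
  set N := LieSubmodule.lieSpan ℂ gl {genVermaIncl S V x}
  let N' : LieSubmodule ℂ (glS S) (GenVerma S V) := { N with lie_mem := fun hz => N.lie_mem hz }
  have hincl (y : V) : genVermaIncl S V y ∈ N :=
    map_mem_of_lieSpan_eq_top (N := N') hx incl (LieSubmodule.subset_lieSpan rfl) y
  refine eq_top_iff.2 fun z _ => ?_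
  obtain ⟨t, rfl⟩ := (genVermaRel S V).mkQ_surjective z
  induction t using TensorProduct.induction_on with
  | zero => rw [map_zero]; exact zero_mem _
  | tmul u y =>
    rw [← smul_genVermaIncl]
    exact smul_mem_of_ι_smul_mem (N := N.toSubmodule) (fun a z hz => N.lie_mem hz) u (hincl y)
  | add s t hs ht => rw [map_add]; exact add_mem (hs trivial) (ht trivial)

theorem exists_genVerma_hom {M : Type*} [AddCommGroup M] [Module ℂ M] [LieRingModule gl M]
    [LieModule ℂ gl M] (f : V →ₗ⁅ℂ,glS S⁆ M) (hf : ∀ x, f x ∈ supportedIn M S) :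
    ∃ F : GenVerma S V →ₗ⁅ℂ,gl⁆ M, ∀ x, F (genVermaIncl S V x) = f x := by
  let _ := liftModule gl M
  have _ := liftModule_isScalarTower gl M
  have _ : SMulCommClass (UniversalEnvelopingAlgebra ℂ gl) ℂ M := IsScalarTower.to_smulCommClass'
  let φ : UniversalEnvelopingAlgebra ℂ gl ⊗[ℂ] V →ₗ[UniversalEnvelopingAlgebra ℂ gl] M :=
    TensorProduct.AlgebraTensorModule.lift
      (LinearMap.toSpanSingleton (UniversalEnvelopingAlgebra ℂ gl) (V →ₗ[ℂ] M) f)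
  have hφ (u : UniversalEnvelopingAlgebra ℂ gl) (x : V) : φ (u ⊗ₜ x) = u • f x := rfl
  have hker : genVermaRel S V ≤ LinearMap.ker φ := by
    rw [genVermaRel, Submodule.span_le]
    rintro _ (⟨a, x, rfl⟩ | ⟨m, n, x, hn, rfl⟩)
    · refine LinearMap.mem_ker.2 ?_
      rw [map_sub, hφ, hφ, one_smul, liftModule_ι_smul, LieModuleHom.map_lie,
        LieSubalgebra.coe_bracket_of_module, sub_self]
    · refine LinearMap.mem_ker.2 ?_
      rw [hφ, liftModule_ι_smul, hf x m n hn]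
  let ψ : GenVerma S V →ₗ[UniversalEnvelopingAlgebra ℂ gl] M := (genVermaRel S V).liftQ φ hker
  refine ⟨{ ψ.restrictScalars ℂ with map_lie' := fun {a x} => ?_ }, fun x => ?_⟩
  · change ψ ⁅a, x⁆ = ⁅a, ψ x⁆
    rw [genVerma_lie, map_smul, liftModule_ι_smul]
  · change φ (1 ⊗ₜ x) = f x
    rw [hφ, one_smul]

end GenVerma

section IrreducibleQuotients

variable (S : Finset ℤ) (lam : Weight)

/-- The highest weight vector of `L(λ_S)`. -/
def lfinGen : LFin S lam :=
  LieSubmodule.Quotient.mk' (maxSubmodule (glS S) (Verma S lam)) (vermaGen S lam)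

theorem lieSpan_lfinGen : LieSubmodule.lieSpan ℂ (glS S) {lfinGen S lam} = ⊤ :=
  lieSpan_quotient_mk (lieSpan_vermaGen S lam) _

theorem isHWFin_lfinGen : IsHWFin S lam (lfinGen S lam) :=
  (isHWFin_vermaGen S lam).map (LieSubmodule.Quotient.mk' (maxSubmodule (glS S) (Verma S lam)))

theorem isHWInf_genVermaIncl : IsHWInf S lam (genVermaIncl S (LFin S lam) (lfinGen S lam)) where
  raise m n h := by rw [lie_genVermaIncl, (isHWFin_lfinGen S lam).raise m n h, map_zero]
  weight n := by rw [lie_genVermaIncl, (isHWFin_lfinGen S lam).weight n, map_smul]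
  kill m n hn := lie_genVermaIncl_of_notMem hn _

/-- The highest weight vector of `L(S, λ)`. -/
def linfGen : LInf S lam :=
  LieSubmodule.Quotient.mk' (maxSubmodule gl (GenVerma S (LFin S lam)))
    (genVermaIncl S (LFin S lam) (lfinGen S lam))

theorem lieSpan_linfGen : LieSubmodule.lieSpan ℂ gl {linfGen S lam} = ⊤ :=
  lieSpan_quotient_mk (lieSpan_genVermaIncl (lieSpan_lfinGen S lam)) _

theorem isHWInf_linfGen : IsHWInf S lam (linfGen S lam) :=
  (isHWInf_genVermaIncl S lam).map
    (LieSubmodule.Quotient.mk' (maxSubmodule gl (GenVerma S (LFin S lam))))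

variable {S lam}

theorem IsHWFin.exists_hom {X : Type*} [AddCommGroup X] [Module ℂ X] [LieRingModule (glS S) X]
    [LieModule ℂ (glS S) X] {v : X} (hv : IsHWFin S lam v) (B : ContraForm (EFin S) X)
    (h0 : v ≠ 0) :
    ∃ f : LFin S lam →ₗ⁅ℂ,glS S⁆ X, Function.Injective f ∧ f (lfinGen S lam) = v := by
  obtain ⟨g, hg⟩ := exists_verma_hom hv
  have hker := (isHWFin_vermaGen S lam).isHighest.ker_eq_maxSubmodule (isGlFamily_EFin S)
    (lieSpan_vermaGen S lam) B (B.form_degreeElement_lie _ _) g (hg ▸ h0)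
  obtain ⟨F, hF, hFg⟩ := exists_injective_quotient_hom g hker
  exact ⟨F, hF, (hFg _).trans hg⟩

theorem IsHWInf.exists_hom {M : Type*} [AddCommGroup M] [Module ℂ M] [LieRingModule gl M]
    [LieModule ℂ gl M] {v : M} (hv : IsHWInf S lam v) (B : ContraForm E M) (h0 : v ≠ 0) :
    ∃ f : LInf S lam →ₗ⁅ℂ,gl⁆ M, Function.Injective f ∧ f (linfGen S lam) = v := by
  obtain ⟨f, -, hf⟩ := hv.toIsHWFin.exists_hom (B.toFin S) h0
  have hsupp : f (lfinGen S lam) ∈ supportedFin M S := hf ▸ hv.kill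
  obtain ⟨g, hg⟩ :=
    exists_genVerma_hom f (map_mem_of_lieSpan_eq_top (lieSpan_lfinGen S lam) f hsupp)
  have hgv : g (genVermaIncl S (LFin S lam) (lfinGen S lam)) = v := (hg _).trans hf
  have hker := (isHWInf_genVermaIncl S lam).isHighest.ker_eq_maxSubmodule isGlFamily_E
    (lieSpan_genVermaIncl (lieSpan_lfinGen S lam)) B (B.form_degreeElement_lie _ _) g (hgv ▸ h0)
  obtain ⟨F, hF, hFg⟩ := exists_injective_quotient_hom g hker
  exact ⟨F, hF, (hFg _).trans hgv⟩

theorem IsHWFin.isIrreducible {X : Type*} [AddCommGroup X] [Module ℂ X] [LieRingModule (glS S) X]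
    [LieModule ℂ (glS S) X] {v : X} (hv : IsHWFin S lam v) (h0 : v ≠ 0) :
    LieModule.IsIrreducible ℂ (glS S) (LFin S lam) := by
  obtain ⟨g, hg⟩ := exists_verma_hom hv
  refine isIrreducible_quotient_maxSubmodule fun h => ?_
  refine (isHWFin_vermaGen S lam).isHighest.notMem_maxSubmodule (lieSpan_vermaGen S lam)
    (fun h1 => h0 ?_) (h ▸ LieSubmodule.mem_top _)
  rw [← hg, h1, map_zero]

theorem IsHWInf.isIrreducible {M : Type*} [AddCommGroup M] [Module ℂ M] [LieRingModule gl M]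
    [LieModule ℂ gl M] {v : M} (hv : IsHWInf S lam v) (B : ContraForm E M) (h0 : v ≠ 0) :
    LieModule.IsIrreducible ℂ gl (LInf S lam) := by
  obtain ⟨f, -, hf⟩ := hv.exists_hom B h0
  refine isIrreducible_quotient_maxSubmodule fun h => h0 ?_
  have hgen : linfGen S lam = 0 :=
    (LieSubmodule.Quotient.mk_eq_zero _).2 (h ▸ LieSubmodule.mem_top _)
  rw [← hf, hgen, map_zero]

end IrreducibleQuotients

section PolynomialModule

open MvPolynomial

/-- The algebra `ℂ[Vec ⊗ ℂ^J]` of polynomials in variables `x_{i,j}` with `i ∈ ℤ` and `j ∈ J`, on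
which `E_{m,n}` acts as the derivation `∑ⱼ x_{m,j} ∂/∂x_{n,j}`. -/
abbrev Pol (J : Type) : Type := MvPolynomial (ℤ × J) ℂ

section Action

variable {J : Type}

/-- The unit vector at `a`. -/
def unitVec (a : ℤ) : Vec := (Finsupp.single a 1 : ℤ →₀ ℂ)

theorem vec_hom_ext {X : Type*} [AddCommGroup X] [Module ℂ X] {f g : Vec →ₗ[ℂ] X}
    (h : ∀ a, f (unitVec a) = g (unitVec a)) : f = g :=
  Finsupp.lhom_ext' (M := ℂ) fun a => LinearMap.ext_ring (h a)

theorem unit_unitVec (m n a : ℤ) : unit m n (unitVec a) = if n = a then unitVec m else 0 := by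
  change (Finsupp.single m ((Finsupp.single a 1 : ℤ →₀ ℂ) n) : ℤ →₀ ℂ) = _
  split_ifs with h
  · subst h; rw [Finsupp.single_eq_same]; rfl
  · rw [Finsupp.single_eq_of_ne h, Finsupp.single_zero]; rfl

/-- The vector `∑ uₐ eₐ` as the linear form `∑ uₐ x_{a,j}`. -/
def colMap (j : J) : Vec →ₗ[ℂ] Pol J :=
  (Finsupp.linearCombination ℂ fun a : ℤ => (X (a, j) : Pol J) : (ℤ →₀ ℂ) →ₗ[ℂ] Pol J)

theorem colMap_unitVec (j : J) (a : ℤ) : colMap j (unitVec a) = X (a, j) := by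
  change Finsupp.linearCombination ℂ (fun a : ℤ => (X (a, j) : Pol J)) (Finsupp.single a 1) = _
  rw [Finsupp.linearCombination_single, one_smul]

/-- The derivation by which an operator on column vectors acts on polynomials. -/
def polDer (A : Module.End ℂ Vec) : Derivation ℂ (Pol J) (Pol J) :=
  mkDerivation ℂ fun s => colMap s.2 (A (unitVec s.1))

theorem polDer_X (A : Module.End ℂ Vec) (a : ℤ) (j : J) :
    polDer A (X (a, j)) = colMap j (A (unitVec a)) := mkDerivation_X _ _ _

theorem polDer_colMap (A : Module.End ℂ Vec) (j : J) (u : Vec) :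
    polDer A (colMap j u) = colMap j (A u) := by
  have h : ((polDer A : Derivation ℂ (Pol J) (Pol J)) : Pol J →ₗ[ℂ] Pol J).comp (colMap j) =
      (colMap j).comp A := vec_hom_ext fun a => by
    change polDer A (colMap j (unitVec a)) = colMap j (A (unitVec a))
    rw [colMap_unitVec, polDer_X]
  exact LinearMap.congr_fun h u

/-- The homomorphism `A ↦ polDer A` of Lie algebras. -/
def polDerHom (J : Type) : Module.End ℂ Vec →ₗ⁅ℂ⁆ Derivation ℂ (Pol J) (Pol J) where
  toFun := polDer
  map_add' A B := derivation_ext fun s => by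
    rw [Derivation.add_apply, polDer_X, polDer_X, polDer_X, LinearMap.add_apply, map_add]
  map_smul' t A := derivation_ext fun s => by
    rw [RingHom.id_apply, Derivation.smul_apply, polDer_X, polDer_X, LinearMap.smul_apply, map_smul]
  map_lie' {A B} := derivation_ext fun s => by
    rw [Derivation.commutator_apply, polDer_X, polDer_X, polDer_X, polDer_colMap, polDer_colMap,
      ← map_sub]
    rfl

instance : LieRingModule gl (Pol J) := LieRingModule.compLieHom _ ((polDerHom J).comp gl.incl)

instance : LieModule ℂ gl (Pol J) := LieModule.compLieHom _ ((polDerHom J).comp gl.incl)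

theorem pol_lie (A : gl) (p : Pol J) : ⁅A, p⁆ = polDer (A : Module.End ℂ Vec) p := rfl

theorem lie_mul (A : gl) (p q : Pol J) : ⁅A, p * q⁆ = p * ⁅A, q⁆ + ⁅A, p⁆ * q := by
  rw [pol_lie, Derivation.leibniz, smul_eq_mul, smul_eq_mul, mul_comm q]; rfl

theorem lie_X (A : gl) (a : ℤ) (j : J) :
    ⁅A, (X (a, j) : Pol J)⁆ = colMap j ((A : Module.End ℂ Vec) (unitVec a)) := polDer_X _ _ _

theorem lie_C (A : gl) (t : ℂ) : ⁅A, (C t : Pol J)⁆ = 0 := derivation_C _ _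

theorem E_lie_X (m n a : ℤ) (j : J) :
    ⁅E m n, (X (a, j) : Pol J)⁆ = if n = a then X (m, j) else 0 := by
  rw [lie_X]
  change colMap j (unit m n (unitVec a)) = _
  rw [unit_unitVec, apply_ite (colMap j), colMap_unitVec, map_zero]

variable [Fintype J]

theorem E_lie_pol (m n : ℤ) (p : Pol J) : ⁅E m n, p⁆ = ∑ j, X (m, j) * pderiv (n, j) p := by
  classical
  induction p using MvPolynomial.induction_on with
  | C t => simp only [lie_C, pderiv_C, mul_zero, Finset.sum_const_zero]
  | add p q hp hq => simp only [lie_add, hp, hq, map_add, mul_add, Finset.sum_add_distrib]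
  | mul_X p s hp =>
    obtain ⟨a, i⟩ := s
    have hX : ∑ j, (X (m, j) : Pol J) * pderiv (n, j) (X (a, i)) = ⁅E m n, (X (a, i) : Pol J)⁆ := by
      rw [E_lie_X, Finset.sum_eq_single i]
      · by_cases h : n = a
        · rw [if_pos h, h, pderiv_X_self, mul_one]
        · rw [if_neg h, pderiv_X_of_ne fun h' => h (congrArg Prod.fst h').symm, mul_zero]
      · intro j _ hj
        rw [pderiv_X_of_ne fun h' => hj (congrArg Prod.snd h').symm, mul_zero]
      · exact fun h => absurd (Finset.mem_univ i) h
    rw [lie_mul, hp, ← hX, Finset.mul_sum, Finset.sum_mul, ← Finset.sum_add_distrib]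
    refine Finset.sum_congr rfl fun j _ => ?_
    rw [pderiv_mul]
    ring

/-- The exponents of a monomial, added up over each row. -/
def rowDegree (α : ℤ × J →₀ ℕ) : ℤ →₀ ℕ := α.mapDomain Prod.fst

theorem rowDegree_apply (α : ℤ × J →₀ ℕ) (n : ℤ) : rowDegree α n = ∑ j, α (n, j) := by
  classical
  rw [rowDegree]
  induction α using Finsupp.induction_linear with
  | zero => simp
  | add α β hα hβ => simp only [Finsupp.mapDomain_add, Finsupp.add_apply, hα, hβ,
      Finset.sum_add_distrib]
  | single s k =>
    simp only [Finsupp.mapDomain_single, Finsupp.single_apply, Prod.ext_iff]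
    by_cases h : s.1 = n <;> simp [h]

omit [Fintype J]

variable [Finite J]

theorem E_lie_monomial (n : ℤ) (α : ℤ × J →₀ ℕ) (t : ℂ) :
    ⁅E n n, monomial α t⁆ = (rowDegree α n : ℂ) • monomial α t := by
  have := Fintype.ofFinite J
  rw [E_lie_pol, rowDegree_apply, Nat.cast_sum, Finset.sum_smul]
  refine Finset.sum_congr rfl fun j _ => ?_
  rw [X_mul_pderiv_monomial, Nat.cast_smul_eq_nsmul]

theorem coeff_E_lie (n : ℤ) (α : ℤ × J →₀ ℕ) (p : Pol J) :
    coeff α ⁅E n n, p⁆ = (rowDegree α n : ℂ) * coeff α p := by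
  classical
  induction p using MvPolynomial.induction_on' with
  | monomial β t =>
    rw [E_lie_monomial, coeff_smul, coeff_monomial, smul_eq_mul]
    split_ifs with h
    · rw [h]
    · rw [mul_zero, mul_zero]
  | add p q hp hq => rw [lie_add, coeff_add, coeff_add, hp, hq, mul_add]

theorem rowDegree_eq_of_lie_eq {n : ℤ} {t : ℂ} {p : Pol J} (hp : ⁅E n n, p⁆ = t • p)
    {α : ℤ × J →₀ ℕ} (hα : α ∈ p.support) : (rowDegree α n : ℂ) = t := by
  have h := coeff_E_lie n α p
  rw [hp, coeff_smul, smul_eq_mul] at h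
  exact (mul_right_cancel₀ (mem_support_iff.1 hα) h).symm

theorem exponent_eq_zero_of_lie_eq_zero {n : ℤ} {p : Pol J} (hp : ⁅E n n, p⁆ = 0)
    {α : ℤ × J →₀ ℕ} (hα : α ∈ p.support) (j : J) : α (n, j) = 0 := by
  have := Fintype.ofFinite J
  have h := rowDegree_eq_of_lie_eq (t := 0) (hp.trans (zero_smul ℂ p).symm) hα
  rw [Nat.cast_eq_zero, rowDegree_apply, Finset.sum_eq_zero_iff] at h
  exact h j (Finset.mem_univ j)

theorem E_lie_eq_zero {n : ℤ} {p : Pol J} (hp : ⁅E n n, p⁆ = 0) (m : ℤ) : ⁅E m n, p⁆ = 0 := by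
  have := Fintype.ofFinite J
  rw [E_lie_pol]
  refine Finset.sum_eq_zero fun j _ => ?_
  rw [pderiv_eq_zero_of_notMem_vars, mul_zero]
  intro hv
  obtain ⟨α, hα, hj⟩ := (mem_vars_iff_mem_support _).1 hv
  exact Finsupp.mem_support_iff.1 hj (exponent_eq_zero_of_lie_eq_zero hp hα j)

end Action

section Fock

variable {σ : Type*}

/-- The product `α! = ∏ αₛ!` of the factorials of the exponents. -/
def factorialWeight (α : σ →₀ ℕ) : ℕ := α.prod fun _ k => k.factorial

theorem factorialWeight_pos (α : σ →₀ ℕ) : 0 < factorialWeight α :=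
  Finset.prod_pos fun _ _ => Nat.factorial_pos _

theorem factorialWeight_add_single (α : σ →₀ ℕ) (s : σ) :
    factorialWeight (α + Finsupp.single s 1) = (α s + 1) * factorialWeight α := by
  have h (β : σ →₀ ℕ) : factorialWeight β = (β s).factorial * factorialWeight (β.erase s) :=
    (Finsupp.mul_prod_erase' β s _ fun _ => rfl).symm
  rw [h (α + _), h α, Finsupp.erase_add, Finsupp.erase_single, add_zero, Finsupp.add_apply,
    Finsupp.single_eq_same, Nat.factorial_succ, mul_assoc]

/-- The bilinear form for which the monomials are orthogonal and `⟨x^α, x^α⟩ = α!`. -/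
def fockBilin : MvPolynomial σ ℂ →ₗ[ℂ] MvPolynomial σ ℂ →ₗ[ℂ] ℂ :=
  (basisMonomials σ ℂ).constr ℂ fun α => (factorialWeight α : ℂ) • lcoeff ℂ α

theorem fockBilin_monomial (α : σ →₀ ℕ) (t : ℂ) (q : MvPolynomial σ ℂ) :
    fockBilin (monomial α t) q = t * (factorialWeight α * coeff α q) := by
  have h : monomial α t = t • basisMonomials σ ℂ α := by
    rw [coe_basisMonomials, smul_monomial, smul_eq_mul, mul_one]
  rw [h, map_smul, fockBilin, Module.Basis.constr_basis]
  rfl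

theorem fockBilin_symm (p q : MvPolynomial σ ℂ) : fockBilin p q = fockBilin q p := by
  classical
  induction p using MvPolynomial.induction_on' with
  | monomial α t =>
    induction q using MvPolynomial.induction_on' with
    | monomial β u =>
      rw [fockBilin_monomial, fockBilin_monomial, coeff_monomial, coeff_monomial]
      by_cases h : α = β
      · rw [h, if_pos rfl, if_pos rfl, mul_left_comm t, mul_left_comm u, mul_comm t]
      · rw [if_neg h, if_neg (Ne.symm h), mul_zero, mul_zero, mul_zero, mul_zero]
    | add p q hp hq => rw [map_add, map_add, LinearMap.add_apply, hp, hq]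
  | add p q hp hq => rw [map_add, map_add, LinearMap.add_apply, hp, hq]

theorem fockBilin_X_mul (s : σ) (p q : MvPolynomial σ ℂ) :
    fockBilin (X s * p) q = fockBilin p (pderiv s q) := by
  induction p using MvPolynomial.induction_on' with
  | monomial α t =>
    rw [X, monomial_mul, one_mul, add_comm, fockBilin_monomial, fockBilin_monomial, coeff_pderiv,
      factorialWeight_add_single]
    push_cast
    ring
  | add p q hp hq =>
    rw [mul_add, map_add, map_add, LinearMap.add_apply, LinearMap.add_apply, hp, hq]

/-- Complex conjugation of the coefficients. -/
def conjPol : MvPolynomial σ ℂ →ₗ⋆[ℂ] MvPolynomial σ ℂ where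
  toFun p := map (starRingEnd ℂ) p
  map_add' p q := map_add _ p q
  map_smul' t p := by rw [smul_eq_C_mul, smul_eq_C_mul, map_mul, map_C]

theorem fockBilin_conj_self (p : MvPolynomial σ ℂ) :
    fockBilin (conjPol p) p =
      ((∑ α ∈ p.support, (factorialWeight α : ℝ) * Complex.normSq (coeff α p) : ℝ) : ℂ) := by
  conv_lhs => rw [show conjPol p = conjPol (∑ α ∈ p.support, monomial α (coeff α p)) by
    rw [← p.as_sum]]
  rw [map_sum, map_sum, LinearMap.sum_apply, Complex.ofReal_sum]
  refine Finset.sum_congr rfl fun α _ => ?_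
  have hconj : conjPol (monomial α (coeff α p)) = monomial α ((starRingEnd ℂ) (coeff α p)) :=
    map_monomial _ _ _
  rw [hconj, fockBilin_monomial, Complex.ofReal_mul, Complex.normSq_eq_conj_mul_self,
    Complex.ofReal_natCast]
  ring

theorem conjPol_E_lie {J : Type} [Finite J] (m n : ℤ) (p : Pol J) :
    conjPol ⁅E m n, p⁆ = ⁅E m n, conjPol p⁆ := by
  have := Fintype.ofFinite J
  rw [E_lie_pol, E_lie_pol, map_sum]
  refine Finset.sum_congr rfl fun j _ => ?_
  change map _ (X (m, j) * pderiv (n, j) p) = X (m, j) * pderiv (n, j) (map _ p)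
  rw [map_mul, map_X, pderiv_map]

/-- The Fock form `⟨p, q⟩ = ∑ α! \bar{p_α} q_α`; multiplication by `x_{m,j}` is adjoint to
`∂/∂x_{m,j}`. -/
def fockForm (J : Type) [Fintype J] : ContraForm E (Pol J) where
  form := fockBilin.comp conjPol
  contra m n p q := by
    change fockBilin (conjPol ⁅E m n, p⁆) q = fockBilin (conjPol p) ⁅E n m, q⁆
    rw [conjPol_E_lie, fockBilin_symm (conjPol p), E_lie_pol, E_lie_pol, map_sum, map_sum,
      LinearMap.sum_apply, LinearMap.sum_apply]
    refine Finset.sum_congr rfl fun j _ => ?_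
    rw [fockBilin_X_mul, fockBilin_X_mul, fockBilin_symm]
  pos p hp := by
    change 0 < (fockBilin (conjPol p) p).re
    rw [fockBilin_conj_self, Complex.ofReal_re]
    refine Finset.sum_pos (fun α hα => ?_)
      (Finset.nonempty_iff_ne_empty.2 (mt support_eq_empty.1 hp))
    exact mul_pos (Nat.cast_pos.2 (factorialWeight_pos α))
      (Complex.normSq_pos.2 (mem_support_iff.1 hα))

end Fock

section Minors

theorem derivation_prod {R A ι : Type*} [CommRing R] [CommRing A] [Algebra R A] [DecidableEq ι]
    (D : Derivation R A A) (s : Finset ι) (f : ι → A) :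
    D (∏ i ∈ s, f i) = ∑ i ∈ s, (∏ k ∈ s.erase i, f k) * D (f i) := by
  induction s using Finset.induction_on with
  | empty => simp
  | insert a s ha ih =>
    rw [Finset.prod_insert ha, Derivation.leibniz, ih, Finset.sum_insert ha,
      Finset.erase_insert ha, smul_eq_mul, smul_eq_mul, Finset.mul_sum, add_comm]
    congr 1
    refine Finset.sum_congr rfl fun i hi => ?_
    have hia : a ≠ i := fun h => ha (h ▸ hi)
    rw [Finset.erase_insert_of_ne hia,
      Finset.prod_insert fun h => ha (Finset.mem_of_mem_erase h), mul_assoc]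

theorem derivation_det {R A ι : Type*} [CommRing R] [CommRing A] [Algebra R A] [DecidableEq ι]
    [Fintype ι] (D : Derivation R A A) (M : Matrix ι ι A) :
    D M.det = ∑ i, (M.updateCol i fun j => D (M j i)).det := by
  simp only [Matrix.det_apply', map_sum]
  rw [Finset.sum_comm]
  refine Finset.sum_congr rfl fun τ _ => ?_
  rw [← Finset.mul_sum, Derivation.leibniz, derivation_prod, smul_eq_mul, smul_eq_mul,
    Derivation.map_intCast, mul_zero, add_zero]
  congr 1
  refine Finset.sum_congr rfl fun i hi => ?_
  rw [← Finset.mul_prod_erase _ _ hi, Matrix.updateCol_self, mul_comm]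
  congr 1
  refine Finset.prod_congr rfl fun k hk => ?_
  rw [Matrix.updateCol_ne (Finset.ne_of_mem_erase hk)]

theorem derivation_prod_pow {R A ι : Type*} [CommRing R] [CommRing A] [Algebra R A]
    (D : Derivation R A A) (s : Finset ι) (g : ι → A) (e : ι → ℕ) (c : ι → R)
    (h : ∀ i ∈ s, D (g i) = c i • g i) :
    D (∏ i ∈ s, g i ^ e i) = (∑ i ∈ s, (e i : R) * c i) • ∏ i ∈ s, g i ^ e i := by
  classical
  rw [derivation_prod, Finset.sum_smul]
  refine Finset.sum_congr rfl fun i hi => ?_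
  have hpow : D (g i ^ e i) = ((e i : R) * c i) • g i ^ e i := by
    rw [Derivation.leibniz_pow, h i hi]
    rcases Nat.eq_zero_or_pos (e i) with h0 | h0
    · rw [h0, zero_smul, Nat.cast_zero, zero_mul, zero_smul]
    · rw [smul_comm _ (c i), smul_eq_mul, ← pow_succ, Nat.sub_add_cancel h0, mul_smul,
        Nat.cast_smul_eq_nsmul, smul_comm]
  rw [hpow, mul_smul_comm, Finset.prod_erase_mul _ _ hi]

variable {J : Type} {A : Finset ℤ} {ι : A → J} {m n : ℤ}

/-- The matrix of the variables with rows in `A` and columns `ι i`, `i ∈ A` (transposed). -/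
def minorMatrix (ι : A → J) : Matrix A A (Pol J) := Matrix.of fun j i => X ((i : ℤ), ι j)

/-- The minor of the matrix of the variables with rows in `A` and columns `ι i`, `i ∈ A`. -/
def minor (ι : A → J) : Pol J := (minorMatrix ι).det

theorem E_lie_minor : ⁅E m n, minor ι⁆ =
    ∑ i : A, ((minorMatrix ι).updateCol i fun j => if n = i then X (m, ι j) else 0).det := by
  rw [minor, pol_lie, derivation_det]
  simp only [← pol_lie, minorMatrix, Matrix.of_apply, E_lie_X]

theorem det_updateCol_minorMatrix_of_ne {i : A} (h : n ≠ i) :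
    ((minorMatrix ι).updateCol i fun j => if n = i then X (m, ι j) else 0).det = 0 :=
  Matrix.det_eq_zero_of_column_eq_zero i fun j => by rw [Matrix.updateCol_self, if_neg h]

theorem E_lie_minor_of_notMem (hn : n ∉ A) : ⁅E m n, minor ι⁆ = 0 := by
  rw [E_lie_minor]
  exact Finset.sum_eq_zero fun i _ => det_updateCol_minorMatrix_of_ne fun h => hn (h ▸ i.2)

theorem E_lie_minor_of_mem (hn : n ∈ A) :
    ⁅E m n, minor ι⁆ = ((minorMatrix ι).updateCol ⟨n, hn⟩ fun j => X (m, ι j)).det := by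
  rw [E_lie_minor, Finset.sum_eq_single ⟨n, hn⟩]
  · simp only [if_true]
  · exact fun i _ hi => det_updateCol_minorMatrix_of_ne fun h => hi (Subtype.ext h.symm)
  · exact fun h => absurd (Finset.mem_univ _) h

theorem E_lie_minor_of_ne (hm : m ∈ A) (hmn : m ≠ n) : ⁅E m n, minor ι⁆ = 0 := by
  by_cases hn : n ∈ A
  · rw [E_lie_minor_of_mem hn]
    have hne : (⟨m, hm⟩ : A) ≠ ⟨n, hn⟩ := fun h => hmn (congrArg Subtype.val h)
    refine Matrix.det_zero_of_column_eq hne fun j => ?_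
    rw [Matrix.updateCol_self, Matrix.updateCol_ne hne, minorMatrix, Matrix.of_apply]
  · exact E_lie_minor_of_notMem hn

theorem E_lie_minor_self (hn : n ∈ A) : ⁅E n n, minor ι⁆ = minor ι := by
  rw [E_lie_minor_of_mem hn, minor]
  congr 1
  exact Matrix.updateCol_eq_self (minorMatrix ι) ⟨n, hn⟩

theorem eval_minor (x : ℤ × J → ℂ)
    (hx : ∀ i j : A, x (i, ι j) = if j = i then 1 else 0) : eval x (minor ι) = 1 := by
  rw [minor, RingHom.map_det, ← Matrix.det_one (n := A)]
  congr 1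
  ext j i
  simp [minorMatrix, Matrix.one_apply, hx]

end Minors

section HighestWeightVector

variable {S : Finset ℤ} {k m n : ℤ}

/-- The minor with rows and columns in `{i ∈ S | i ≤ k}` of the matrix of the variables. -/
def leadingMinor (S : Finset ℤ) (k : ℤ) : Pol S :=
  minor fun i : S.filter (· ≤ k) => (⟨i, Finset.mem_of_mem_filter _ i.2⟩ : S)

theorem E_lie_leadingMinor_of_notMem (hn : n ∉ S) : ⁅E m n, leadingMinor S k⁆ = 0 :=
  E_lie_minor_of_notMem fun h => hn (Finset.mem_of_mem_filter _ h)

theorem E_lie_leadingMinor_of_lt (hm : m ∈ S) (hmn : m < n) : ⁅E m n, leadingMinor S k⁆ = 0 := by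
  by_cases hmk : m ≤ k
  · exact E_lie_minor_of_ne (Finset.mem_filter.2 ⟨hm, hmk⟩) hmn.ne
  · exact E_lie_minor_of_notMem fun h => hmk (hmn.le.trans (Finset.mem_filter.1 h).2)

theorem E_lie_leadingMinor_self (hn : n ∈ S) :
    ⁅E n n, leadingMinor S k⁆ = (if n ≤ k then 1 else 0 : ℂ) • leadingMinor S k := by
  split_ifs with hnk
  · rw [one_smul]
    exact E_lie_minor_self (Finset.mem_filter.2 ⟨hn, hnk⟩)
  · rw [zero_smul]
    exact E_lie_minor_of_notMem fun h => hnk (Finset.mem_filter.1 h).2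

theorem leadingMinor_ne_zero : leadingMinor S k ≠ 0 := by
  intro h
  have h1 := eval_minor (ι := fun i : S.filter (· ≤ k) => (⟨i, Finset.mem_of_mem_filter _ i.2⟩ : S))
    (fun s => if s.2 = s.1 then 1 else 0) fun i j => by simp only [Subtype.ext_iff]
  change eval _ (leadingMinor S k) = 1 at h1
  rw [h, map_zero] at h1
  exact zero_ne_one h1

theorem sum_Icc_sub {G : Type*} [AddCommGroup G] (f : ℤ → G) {a b : ℤ} (hab : a ≤ b) :
    ∑ k ∈ Finset.Icc a b, (f k - f (k + 1)) = f a - f (b + 1) := by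
  induction b, hab using Int.leInduction with
  | base => rw [Finset.Icc_self, Finset.sum_singleton]
  | succ b hab ih =>
    rw [← Finset.insert_Icc_right_eq_Icc_add_one (by lia), Finset.sum_insert (by simp), ih]
    abel

/-- The extension by `sup` to `ℤ` of the restriction to `S` of a function: it is antitone, vanishes
above `S`, and agrees with `f` on `S` if `f` is antitone on `S`. -/
def tailSup (S : Finset ℤ) (f : ℤ → ℕ) (k : ℤ) : ℕ := (S.filter (k ≤ ·)).sup f

theorem tailSup_antitone (S : Finset ℤ) (f : ℤ → ℕ) : Antitone (tailSup S f) := fun _ _ h =>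
  Finset.sup_mono (Finset.monotone_filter_right _ fun _ _ => h.trans)

theorem tailSup_of_mem {f : ℤ → ℕ} (hf : ∀ i ∈ S, ∀ j ∈ S, i < j → f j ≤ f i) (hk : k ∈ S) :
    tailSup S f k = f k := by
  refine le_antisymm (Finset.sup_le fun j hj => ?_)
    (Finset.le_sup (f := f) (Finset.mem_filter.2 ⟨hk, le_rfl⟩))
  obtain ⟨hjS, hkj⟩ := Finset.mem_filter.1 hj
  rcases hkj.eq_or_lt with rfl | hlt
  · exact le_rfl
  · exact hf k hk j hjS hlt

theorem tailSup_eq_zero {f : ℤ → ℕ} (hk : ∀ i ∈ S, i < k) : tailSup S f k = 0 := by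
  rw [tailSup, Finset.filter_false_of_mem fun i hi => not_le.2 (hk i hi), Finset.sup_empty,
    bot_eq_zero]

theorem sum_tailSup_sub {f : ℤ → ℕ} (hf : ∀ i ∈ S, ∀ j ∈ S, i < j → f j ≤ f i) {a b : ℤ}
    (ha : ∀ i ∈ S, a ≤ i) (hb : ∀ i ∈ S, i ≤ b) (hn : n ∈ S) :
    ∑ k ∈ Finset.Icc a b, ((tailSup S f k - tailSup S f (k + 1) : ℕ) : ℂ) *
      (if n ≤ k then 1 else 0) = f n := by
  have hIcc : (Finset.Icc a b).filter (n ≤ ·) = Finset.Icc n b := by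
    ext k
    have := ha n hn
    simp only [Finset.mem_filter, Finset.mem_Icc]
    lia
  simp only [mul_ite, mul_one, mul_zero]
  rw [← Finset.sum_filter, hIcc]
  have hcast (k : ℤ) :=
    Nat.cast_sub (R := ℂ) (tailSup_antitone S f (Int.le.intro 1 rfl : k ≤ k + 1))
  simp only [hcast]
  rw [sum_Icc_sub (fun k => (tailSup S f k : ℂ)) (hb n hn), tailSup_of_mem hf hn,
    tailSup_eq_zero fun i hi => Int.lt_add_one_of_le (hb i hi), Nat.cast_zero, sub_zero]

/-- The highest weight vector is a product of powers of leading minors; the exponents are the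
successive differences of the weight. -/
theorem exists_isHWInf {lam : Weight} (hlam : lam ∈ Pplus S) :
    ∃ p : Pol S, p ≠ 0 ∧ IsHWInf S lam p := by
  obtain ⟨f, hf, -, hanti⟩ := hlam
  obtain ⟨a, ha⟩ := S.bddBelow
  obtain ⟨b, hb⟩ := S.bddAbove
  let e (k : ℤ) : ℕ := tailSup S f k - tailSup S f (k + 1)
  let p : Pol S := ∏ k ∈ Finset.Icc a b, leadingMinor S k ^ e k
  have lie_p (m n : ℤ) (c : ℤ → ℂ) (hc : ∀ k, ⁅E m n, leadingMinor S k⁆ = c k • leadingMinor S k) :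
      ⁅E m n, p⁆ = (∑ k ∈ Finset.Icc a b, (e k : ℂ) * c k) • p :=
    derivation_prod_pow (polDer (unit m n)) _ _ _ _ fun k _ => hc k
  have lie_p_eq_zero (m n : ℤ) (h : ∀ k, ⁅E m n, leadingMinor S k⁆ = 0) : ⁅E m n, p⁆ = 0 := by
    rw [lie_p m n 0 fun k => by rw [h, Pi.zero_apply, zero_smul]]
    simp only [Pi.zero_apply, mul_zero, Finset.sum_const_zero, zero_smul]
  refine ⟨p, Finset.prod_ne_zero_iff.2 fun k _ => pow_ne_zero _ leadingMinor_ne_zero,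
    ⟨fun m n hmn => lie_p_eq_zero m n fun k => E_lie_leadingMinor_of_lt m.2 hmn, fun n => ?_⟩,
    fun m n hn => lie_p_eq_zero m n fun k => E_lie_leadingMinor_of_notMem hn⟩
  change ⁅E n n, p⁆ = _
  rw [lie_p n n _ fun k => E_lie_leadingMinor_self n.2, hf,
    sum_tailSup_sub hanti (fun _ => (ha ·)) (fun _ => (hb ·)) n.2]

end HighestWeightVector

end PolynomialModule

section PolynomialModules

open MvPolynomial

variable {J J' : Type}

theorem rename_lie (c : J → J') (A : gl) (p : Pol J) :
    rename (Prod.map id c) ⁅A, p⁆ = ⁅A, rename (Prod.map id c) p⁆ := by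
  have hcol (j : J) : (rename (Prod.map id c)).toLinearMap ∘ₗ colMap j = colMap (c j) :=
    vec_hom_ext fun a => by simp [colMap_unitVec]
  induction p using MvPolynomial.induction_on with
  | C t => simp only [lie_C, rename_C, map_zero]
  | add p q hp hq => rw [lie_add, map_add, map_add, lie_add, hp, hq]
  | mul_X p s hp =>
    rw [lie_mul, map_add, map_mul, map_mul, map_mul, lie_mul, hp, rename_X, Prod.map, lie_X, lie_X,
      id, ← hcol]
    rfl

/-- Polynomials in the entries of two families of columns are products of polynomials in either
family. -/
def polTensorEquiv (J J' : Type) : Pol J ⊗[ℂ] Pol J' ≃ₐ[ℂ] Pol (J ⊕ J') :=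
  (tensorEquivSum ℂ (ℤ × J) (ℤ × J') ℂ).trans
    (renameEquiv ℂ (Equiv.prodSumDistrib ℤ J J').symm)

theorem polTensorEquiv_tmul (p : Pol J) (q : Pol J') :
    polTensorEquiv J J' (p ⊗ₜ q) =
      rename (Prod.map id Sum.inl) p * rename (Prod.map id Sum.inr) q := by
  have h : (polTensorEquiv J J').toAlgHom = Algebra.TensorProduct.lift
      (rename (Prod.map id Sum.inl)) (rename (Prod.map id Sum.inr)) fun _ _ => .all _ _ := by
    ext <;> simp [polTensorEquiv, Prod.map]
  exact DFunLike.congr_fun h (p ⊗ₜ q)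

theorem polTensorEquiv_lie (A : gl) (t : Pol J ⊗[ℂ] Pol J') :
    polTensorEquiv J J' ⁅A, t⁆ = ⁅A, polTensorEquiv J J' t⁆ := by
  induction t using TensorProduct.induction_on with
  | zero => rw [lie_zero, map_zero, lie_zero]
  | tmul p q =>
    rw [TensorProduct.LieModule.lie_tmul_right, map_add, polTensorEquiv_tmul, polTensorEquiv_tmul,
      polTensorEquiv_tmul, rename_lie, rename_lie, lie_mul, add_comm]
  | add s t hs ht => rw [lie_add, map_add, hs, ht, map_add, lie_add]

variable {M : Type*} [AddCommGroup M] [Module ℂ M] [LieRingModule gl M] [LieModule ℂ gl M]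
  {M' : Type*} [AddCommGroup M'] [Module ℂ M'] [LieRingModule gl M'] [LieModule ℂ gl M']

/-- A `𝔤𝔩_∞`-module is polynomial if it embeds into one of the modules `Pol J` with `J` finite. -/
def IsPolynomial (M : Type*) [AddCommGroup M] [Module ℂ M] [LieRingModule gl M]
    [LieModule ℂ gl M] : Prop :=
  ∃ (J : Type) (_ : Fintype J) (f : M →ₗ⁅ℂ,gl⁆ Pol J), Function.Injective f

theorem IsPolynomial.nonempty_form (hM : IsPolynomial M) : Nonempty (ContraForm E M) := by
  obtain ⟨J, _, f, hf⟩ := hM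
  exact ⟨(fockForm J).comap f hf⟩

theorem IsPolynomial.lie_eq_zero (hM : IsPolynomial M) {n : ℤ} {x : M} (h : ⁅E n n, x⁆ = 0)
    (m : ℤ) : ⁅E m n, x⁆ = 0 := by
  obtain ⟨J, _, f, hf⟩ := hM
  refine hf ?_
  rw [LieModuleHom.map_lie, map_zero]
  exact E_lie_eq_zero (by rw [← LieModuleHom.map_lie, h, map_zero]) m

theorem IsPolynomial.tensor (hM : IsPolynomial M) (hM' : IsPolynomial M') :
    IsPolynomial (M ⊗[ℂ] M') := by
  obtain ⟨J, _, f, hf⟩ := hM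
  obtain ⟨J', _, f', hf'⟩ := hM'
  let Φ : Pol J ⊗[ℂ] Pol J' →ₗ⁅ℂ,gl⁆ Pol (J ⊕ J') :=
    { (polTensorEquiv J J').toLinearMap with map_lie' := polTensorEquiv_lie _ _ }
  refine ⟨J ⊕ J', inferInstance, Φ.comp (TensorProduct.LieModule.map f f'), ?_⟩
  exact (polTensorEquiv J J').injective.comp
    (TensorProduct.map_injective_of_flat_flat (f : M →ₗ[ℂ] Pol J) (f' : M' →ₗ[ℂ] Pol J') hf hf')

end PolynomialModules

section Weights

variable {M : Type*} [AddCommGroup M] [Module ℂ M] [LieRingModule gl M] [LieModule ℂ gl M]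
  {M' : Type*} [AddCommGroup M'] [Module ℂ M'] [LieRingModule gl M'] [LieModule ℂ gl M']
  {χ ψ : ℤ →₀ ℕ} {d d' : ℕ} {T : Set ℤ}

/-- `v` is a vector of weight `χ`, possibly zero. -/
def IsWeight (χ : ℤ →₀ ℕ) (v : M) : Prop := ∀ i, ⁅E i i, v⁆ = (χ i : ℂ) • v

/-- The span of the weight vectors whose weights are natural numbers with sum `d`: the part of
degree `d` of a polynomial module. -/
def weightSpan (M : Type*) [AddCommGroup M] [Module ℂ M] [LieRingModule gl M]
    (d : ℕ) : Submodule ℂ M :=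
  Submodule.span ℂ {v | ∃ χ : ℤ →₀ ℕ, χ.degree = d ∧ IsWeight χ v}

theorem IsWeight.lie {n : ℤ} {v : M} (hv : IsWeight (χ + Finsupp.single n 1) v)
    (m : ℤ) : IsWeight (χ + Finsupp.single m 1) ⁅E m n, v⁆ := by
  intro i
  have h1 : ⁅⁅E i i, E m n⁆, v⁆ =
      ((if i = m then 1 else 0 : ℂ) - (if i = n then 1 else 0 : ℂ)) • ⁅E m n, v⁆ := by
    rw [E_lie, sub_lie, sub_smul]
    congr 1 <;> split_ifs with h <;> simp [h]
  rw [leibniz_lie, h1, hv i, lie_smul, ← add_smul]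
  congr 1
  simp only [Finsupp.add_apply, Finsupp.single_apply, eq_comm (a := i)]
  push_cast
  ring

theorem exists_add_single {n : ℤ} (h : χ n ≠ 0) : ∃ χ' : ℤ →₀ ℕ, χ = χ' + Finsupp.single n 1 :=
  ⟨χ - Finsupp.single n 1, (tsub_add_cancel_of_le (Finsupp.single_le_iff.2 (by omega))).symm⟩

theorem IsPolynomial.lie_mem_weightSpan (hM : IsPolynomial M) (m n : ℤ) {w : M}
    (hw : w ∈ weightSpan M d) : ⁅E m n, w⁆ ∈ weightSpan M d := by
  refine (Submodule.span_le (p := (weightSpan M d).comap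
    (LieModule.toEnd ℂ gl M (E m n)))).2 ?_ hw
  rintro w ⟨ψ, hψ, hw⟩
  change ⁅E m n, w⁆ ∈ weightSpan M d
  by_cases h0 : ψ n = 0
  · rw [hM.lie_eq_zero (by rw [hw n, h0, Nat.cast_zero, zero_smul])]
    exact zero_mem _
  · obtain ⟨ψ, rfl⟩ := exists_add_single h0
    refine Submodule.subset_span ⟨_, ?_, hw.lie m⟩
    rw [← hψ, map_add, map_add, Finsupp.degree_single, Finsupp.degree_single]

theorem weightSpan_eq_top_of_lieSpan (hM : IsPolynomial M) {v : M} (hv : IsWeight χ v)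
    (hgen : LieSubmodule.lieSpan ℂ gl {v} = ⊤) : weightSpan M χ.degree = ⊤ := by
  have h : LieSubmodule.lieSpan ℂ gl {v} ≤ isGlFamily_E.toLieSubmodule (weightSpan M χ.degree)
      fun m n _ => hM.lie_mem_weightSpan m n := by
    rw [LieSubmodule.lieSpan_le, Set.singleton_subset_iff]
    exact Submodule.subset_span ⟨χ, rfl, hv⟩
  rw [hgen] at h
  exact eq_top_iff.2 fun x _ => h (LieSubmodule.mem_top x)

theorem IsWeight.tmul {x : M} {y : M'} (hx : IsWeight χ x) (hy : IsWeight ψ y) :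
    IsWeight (χ + ψ) (x ⊗ₜ[ℂ] y) := by
  intro i
  rw [TensorProduct.LieModule.lie_tmul_right, hx i, hy i, TensorProduct.tmul_smul,
    ← TensorProduct.smul_tmul', ← add_smul, Finsupp.add_apply, Nat.cast_add]

omit [LieModule ℂ gl M] [LieModule ℂ gl M'] in
theorem eq_top_of_tmul_mem (hd : weightSpan M d = ⊤) (hd' : weightSpan M' d' = ⊤)
    {W : Submodule ℂ (M ⊗[ℂ] M')}
    (h : ∀ χ ψ (x : M) (y : M'), χ.degree = d → ψ.degree = d' → IsWeight χ x → IsWeight ψ y →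
      x ⊗ₜ y ∈ W) : W = ⊤ := by
  rw [eq_top_iff, ← TensorProduct.map₂_mk_top_top_eq_top, ← hd, ← hd', weightSpan, weightSpan,
    Submodule.map₂_span_span, Submodule.span_le]
  rintro _ ⟨x, ⟨χ, hχ, hx⟩, y, ⟨ψ, hψ, hy⟩, rfl⟩
  exact h χ ψ x y hχ hψ hx hy

theorem weightSpan_tensor (hd : weightSpan M d = ⊤) (hd' : weightSpan M' d' = ⊤) :
    weightSpan (M ⊗[ℂ] M') (d + d') = ⊤ :=
  eq_top_of_tmul_mem hd hd' fun χ ψ _ _ hχ hψ hx hy =>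
    Submodule.subset_span ⟨χ + ψ, by rw [map_add, hχ, hψ], hx.tmul hy⟩

theorem IsWeight.mem_supportedIn (hM : IsPolynomial M) {x : M} (hx : IsWeight χ x)
    (hT : ∀ i, i ∉ T → χ i = 0) : x ∈ supportedIn M T := fun m n hn =>
  hM.lie_eq_zero (by rw [hx n, hT n hn, Nat.cast_zero, zero_smul]) m

theorem exists_mem_apply_eq_zero (hT : (χ.degree : ℕ∞) ≤ T.encard) {i : ℤ} (hi : i ∉ T)
    (hχ : χ i ≠ 0) : ∃ t ∈ T, χ t = 0 := by
  by_contra! h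
  have hsub : insert i T ⊆ (χ.support : Set ℤ) :=
    Set.insert_subset (Finsupp.mem_support_iff.2 hχ) fun t ht => Finsupp.mem_support_iff.2 (h t ht)
  have hfin : T.Finite := χ.support.finite_toSet.subset ((Set.subset_insert i T).trans hsub)
  have hcard : T.encard + 1 ≤ T.encard := calc
    T.encard + 1 = (insert i T).encard := (Set.encard_insert_of_notMem hi).symm
    _ ≤ (χ.support : Set ℤ).encard := Set.encard_le_encard hsub
    _ = χ.support.card := Set.encard_coe_eq_coe_finsetCard _
    _ ≤ χ.degree := Nat.cast_le.2 <| by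
      rw [Finsupp.degree_apply, Finset.card_eq_sum_ones]
      exact Finset.sum_le_sum fun t ht => Nat.one_le_iff_ne_zero.2 (Finsupp.mem_support_iff.1 ht)
    _ ≤ T.encard := hT
  exact (ENat.add_one_le_iff hfin.encard_lt_top.ne).1 hcard |>.false

theorem mem_of_lie_mem (hM : IsPolynomial M) {x : M} (hx : IsWeight χ x) {i t : ℤ} (hi : χ i ≠ 0)
    (ht : χ t = 0) {V : Submodule ℂ M} (h : ⁅E i t, ⁅E t i, x⁆⁆ ∈ V) : x ∈ V := by
  have htx : ⁅E t t, x⁆ = 0 := by rw [hx t, ht, Nat.cast_zero, zero_smul]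
  rwa [leibniz_lie, hM.lie_eq_zero htx i, lie_zero, add_zero, E_lie, if_pos rfl, if_pos rfl,
    sub_lie, htx, sub_zero, hx i, V.smul_mem_iff (Nat.cast_ne_zero.2 hi)] at h

/-- As `#T` is at least the degree, boxes outside `T` can be moved one at a time to free places
in `T`. -/
theorem eq_top_of_supportedIn_le (hM : IsPolynomial M) (hd : weightSpan M d = ⊤)
    (hT : (d : ℕ∞) ≤ T.encard) {V : Submodule ℂ M} (hV : supportedIn M T ≤ V)
    (hst : ∀ i, ∀ t ∈ T, ∀ x ∈ V, ⁅E i t, x⁆ ∈ V) : V = ⊤ := by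
  classical
  have key (k : ℕ) (χ : ℤ →₀ ℕ) (x : M) (hk : (χ.filter (· ∉ T)).degree = k)
      (hχ : χ.degree = d) (hx : IsWeight χ x) : x ∈ V := by
    induction k generalizing χ x with
    | zero =>
      refine hV (hx.mem_supportedIn hM fun i hi => ?_)
      rw [← Finsupp.filter_apply_pos (· ∉ T) χ hi, (Finsupp.degree_eq_zero_iff _).1 hk,
        Finsupp.zero_apply]
    | succ k ih =>
      obtain ⟨i, hi⟩ : (χ.filter (· ∉ T)).support.Nonempty :=
        Finsupp.support_nonempty_iff.2 fun h => by simp [h] at hk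
      rw [Finsupp.support_filter, Finset.mem_filter, Finsupp.mem_support_iff] at hi
      obtain ⟨hi, hiT⟩ := hi
      obtain ⟨t, ht, ht0⟩ := exists_mem_apply_eq_zero (hχ ▸ hT) hiT hi
      refine mem_of_lie_mem hM hx hi ht0 (hst i t ht _ ?_)
      obtain ⟨χ', rfl⟩ := exists_add_single hi
      refine ih (χ' + Finsupp.single t 1) _ ?_ ?_ (hx.lie t)
      · rw [Finsupp.filter_add, map_add, Finsupp.filter_single_of_pos (· ∉ T) hiT,
          Finsupp.degree_single] at hk
        rw [Finsupp.filter_add, map_add, Finsupp.filter_single_of_neg (· ∉ T) (not_not.2 ht),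
          map_zero]
        omega
      · rw [← hχ, map_add, map_add, Finsupp.degree_single, Finsupp.degree_single]
  rw [eq_top_iff, ← hd, weightSpan, Submodule.span_le]
  rintro x ⟨χ, hχ, hx⟩
  exact key _ χ x rfl hχ hx

end Weights

section OuterPart

variable {M : Type*} [AddCommGroup M] [Module ℂ M] [LieRingModule gl M] [LieModule ℂ gl M]
  {T : Set ℤ}

/-- The span of the images of the matrix units with row index outside `T`. For the contravariant
form it is orthogonal to `supportedIn M T`. -/
def outerPart (M : Type*) [AddCommGroup M] [Module ℂ M] [LieRingModule gl M] (T : Set ℤ) :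
    Submodule ℂ M :=
  Submodule.span ℂ {x | ∃ m ∉ T, ∃ (n : ℤ) (y : M), x = ⁅E m n, y⁆}

omit [LieModule ℂ gl M] in
theorem lie_mem_outerPart {m : ℤ} (hm : m ∉ T) (n : ℤ) (y : M) : ⁅E m n, y⁆ ∈ outerPart M T :=
  Submodule.subset_span ⟨m, hm, n, y, rfl⟩

theorem disjoint_supportedIn_outerPart (B : ContraForm E M) :
    Disjoint (supportedIn M T) (outerPart M T) := by
  refine Submodule.disjoint_def.2 fun x hx hx' => B.eq_zero ?_
  have hle : outerPart M T ≤ LinearMap.ker (B.form x) := by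
    rw [outerPart, Submodule.span_le]
    rintro _ ⟨m, hm, n, y, rfl⟩
    rw [SetLike.mem_coe, LinearMap.mem_ker, ← B.contra, hx n m hm, map_zero, LinearMap.zero_apply]
  exact LinearMap.mem_ker.1 (hle hx')

theorem sup_outerPart_inf_supportedIn (B : ContraForm E M) {V : Submodule ℂ M}
    (hV : V ≤ supportedIn M T) : (V ⊔ outerPart M T) ⊓ supportedIn M T = V := by
  rw [sup_inf_assoc_of_le _ hV, inf_comm, (disjoint_supportedIn_outerPart B).eq_bot, sup_bot_eq]

theorem mem_of_mem_lieSpan (B : ContraForm E M) {V : Submodule ℂ M} (hV : V ≤ supportedIn M T)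
    (hst : ∀ m ∈ T, ∀ n ∈ T, ∀ x ∈ V, ⁅E m n, x⁆ ∈ V) {x : M} (hx : x ∈ supportedIn M T)
    (hx' : x ∈ LieSubmodule.lieSpan ℂ gl (V : Set M)) : x ∈ V := by
  have hspan : Submodule.span ℂ
      ({x | ∃ m ∉ T, ∃ n, x = E m n} ∪ {x | ∃ m ∈ T, ∃ n, x = E m n}) = ⊤ := by
    rw [← isGlFamily_E.span_eq]
    congr 1
    ext x
    refine ⟨?_, fun ⟨m, n, hx⟩ => ?_⟩
    · rintro (⟨m, -, n, hx⟩ | ⟨m, -, n, hx⟩) <;> exact ⟨m, n, hx⟩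
    · exact (em (m ∈ T)).symm.imp (fun hm => ⟨m, hm, n, hx⟩) fun hm => ⟨m, hm, n, hx⟩
  rw [← sup_outerPart_inf_supportedIn B hV]
  refine ⟨lieSpan_toSubmodule_le hspan le_sup_left ?_ ?_ hx', hx⟩
  · rintro _ ⟨m, hm, n, rfl⟩ y hy
    by_cases hn : n ∈ T
    · exact hst m hm n hn y hy
    · rw [hV hy m n hn]
      exact zero_mem _
  · rintro _ ⟨m, hm, n, rfl⟩ y -
    exact Submodule.mem_sup_right (lie_mem_outerPart hm n y)

theorem supportedIn_le_of_isIrreducible [LieModule.IsIrreducible ℂ gl M] (B : ContraForm E M)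
    {V : Submodule ℂ M} (hst : ∀ m ∈ T, ∀ n ∈ T, ∀ x ∈ V, ⁅E m n, x⁆ ∈ V) {v : M}
    (hv : v ∈ supportedIn M T) (hvV : v ∈ V) (h0 : v ≠ 0) : supportedIn M T ≤ V := by
  intro x hx
  let U : Submodule ℂ M := V ⊓ supportedIn M T
  have hvU : v ∈ LieSubmodule.lieSpan ℂ gl (U : Set M) := LieSubmodule.subset_lieSpan ⟨hvV, hv⟩
  have hne : LieSubmodule.lieSpan ℂ gl (U : Set M) ≠ ⊥ := fun h =>
    h0 ((LieSubmodule.mem_bot v).1 (h ▸ hvU))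
  refine (mem_of_mem_lieSpan B (V := U) inf_le_right (fun m hm n hn y hy =>
    ⟨hst m hm n hn y hy.1, lie_mem_supportedIn hy.2 hm n⟩) hx ?_).1
  rw [(eq_bot_or_eq_top _).resolve_left hne]
  exact LieSubmodule.mem_top x

end OuterPart

section CyclicTensor

variable {R L M M' : Type*} [CommRing R] [LieRing L] [LieAlgebra R L]
  [AddCommGroup M] [Module R M] [LieRingModule L M] [LieModule R L M]
  [AddCommGroup M'] [Module R M'] [LieRingModule L M'] [LieModule R L M']

theorem eq_top_of_forall_tmul_mem [LieModule.IsIrreducible R L M']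
    {N : LieSubmodule R L (M ⊗[R] M')} {w : M'} (hw : w ≠ 0) (h : ∀ x : M, x ⊗ₜ w ∈ N) :
    N = ⊤ := by
  let V : LieSubmodule R L M' :=
    { carrier := {y | ∀ x : M, x ⊗ₜ[R] y ∈ N}
      add_mem' := fun hy hz x => by rw [TensorProduct.tmul_add]; exact add_mem (hy x) (hz x)
      zero_mem' := fun x => by rw [TensorProduct.tmul_zero]; exact zero_mem _
      smul_mem' := fun t y hy x => by rw [TensorProduct.tmul_smul]; exact N.smul_mem t (hy x)
      lie_mem := fun {a y} hy x => by
        rw [← add_sub_cancel_left (⁅a, x⁆ ⊗ₜ y) (x ⊗ₜ ⁅a, y⁆),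
          ← TensorProduct.LieModule.lie_tmul_right]
        exact sub_mem (N.lie_mem (hy x)) (hy ⁅a, x⁆) }
  have hwV : w ∈ V := h
  have hV : V = ⊤ := (eq_bot_or_eq_top V).resolve_left fun hbot =>
    hw ((LieSubmodule.mem_bot w).1 (hbot ▸ hwV))
  rw [← LieSubmodule.toSubmodule_eq_top, eq_top_iff, ← TensorProduct.span_tmul_eq_top,
    Submodule.span_le]
  rintro _ ⟨x, y, rfl⟩
  exact (hV ▸ LieSubmodule.mem_top y : y ∈ V) x

end CyclicTensor

section CyclicPolynomial

variable {M : Type*} [AddCommGroup M] [Module ℂ M] [LieRingModule gl M] [LieModule ℂ gl M]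
  {M' : Type*} [AddCommGroup M'] [Module ℂ M'] [LieRingModule gl M'] [LieModule ℂ gl M']
  {d d' : ℕ}

theorem supportedIn_ne_bot [Nontrivial M] (hM : IsPolynomial M) (hd : weightSpan M d = ⊤)
    {T : Set ℤ} (hT : (d : ℕ∞) ≤ T.encard) : supportedIn M T ≠ ⊥ := fun h => by
  refine bot_ne_top (eq_top_of_supportedIn_le hM hd hT h.le fun i t _ x hx => ?_)
  rw [(Submodule.mem_bot ℂ).1 hx, lie_zero]
  exact zero_mem _

/-- A generator is `v ⊗ w` with `v`, `w` nonzero and supported in complementary infinite sets: the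
operators `E_{m,n}` with `n` in the first set then act on `v` alone. -/
theorem isCyclicModule_tensor [LieModule.IsIrreducible ℂ gl M] [LieModule.IsIrreducible ℂ gl M']
    (hM : IsPolynomial M) (hM' : IsPolynomial M') (hd : weightSpan M d = ⊤)
    (hd' : weightSpan M' d' = ⊤) : IsCyclicModule gl (M ⊗[ℂ] M') := by
  have : Nontrivial M := (LieSubmodule.nontrivial_iff ℂ gl M).1 inferInstance
  have : Nontrivial M' := (LieSubmodule.nontrivial_iff ℂ gl M').1 inferInstance
  obtain ⟨B⟩ := hM.nonempty_form
  have hT : (d : ℕ∞) ≤ (Set.Ici (0 : ℤ)).encard := by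
    rw [(Set.Ici_infinite (0 : ℤ)).encard_eq]; exact le_top
  have hT' : (d' : ℕ∞) ≤ (Set.Iio (0 : ℤ)).encard := by
    rw [(Set.Iio_infinite (0 : ℤ)).encard_eq]; exact le_top
  obtain ⟨v, hv, hv0⟩ := (Submodule.ne_bot_iff _).1 (supportedIn_ne_bot hM hd hT)
  obtain ⟨w, hw, hw0⟩ := (Submodule.ne_bot_iff _).1 (supportedIn_ne_bot hM' hd' hT')
  set N := LieSubmodule.lieSpan ℂ gl {v ⊗ₜ[ℂ] w}
  let V : Submodule ℂ M := N.toSubmodule.comap ((TensorProduct.mk ℂ M M').flip w)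
  have hst (m n : ℤ) (hn : n ∈ Set.Ici 0) (x : M) (hx : x ∈ V) : ⁅E m n, x⁆ ∈ V := by
    have h : ⁅E m n, x ⊗ₜ[ℂ] w⁆ ∈ N := N.lie_mem hx
    rwa [TensorProduct.LieModule.lie_tmul_right, hw m n (Set.notMem_Iio.2 hn),
      TensorProduct.tmul_zero, add_zero] at h
  have hle : supportedIn M (Set.Ici 0) ≤ V := supportedIn_le_of_isIrreducible B
    (fun m _ n hn => hst m n hn) hv (LieSubmodule.subset_lieSpan rfl) hv0
  have hV : V = ⊤ := eq_top_of_supportedIn_le hM hd hT hle fun i t ht => hst i t ht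
  exact ⟨v ⊗ₜ w, eq_top_of_forall_tmul_mem hw0 fun x => (hV ▸ Submodule.mem_top : x ∈ V)⟩

end CyclicPolynomial

section InitialSegments

/-- `S` is an initial segment of `T`: a dominant weight of `𝔤𝔩_S` extended by zero is then dominant
for `𝔤𝔩_T`. -/
structure IsInitial (S T : Finset ℤ) : Prop where
  subset : S ⊆ T
  mem_of_le : ∀ i ∈ T, ∀ j ∈ S, i ≤ j → i ∈ S

theorem IsInitial.refl (S : Finset ℤ) : IsInitial S S := ⟨subset_rfl, fun _ hi _ _ _ => hi⟩

theorem isInitial_Icc {r n m : ℤ} (h : n ≤ m) : IsInitial (Finset.Icc r n) (Finset.Icc r m) where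
  subset := Finset.Icc_subset_Icc_right h
  mem_of_le _ hi _ hj hij :=
    Finset.mem_Icc.2 ⟨(Finset.mem_Icc.1 hi).1, hij.trans (Finset.mem_Icc.1 hj).2⟩

variable {S T : Finset ℤ} {lam : Weight}

theorem IsInitial.isHWInf {M : Type*} [AddCommGroup M] [Module ℂ M] [LieRingModule gl M] {v : M}
    (hST : IsInitial S T) (hlam : lam ∈ Pplus S) (hv : IsHWInf S lam v) : IsHWInf T lam v where
  raise m n hmn := by
    by_cases hn : (n : ℤ) ∈ S
    · exact hv.raise ⟨m, hST.mem_of_le m m.2 n hn (le_of_lt hmn)⟩ ⟨n, hn⟩ hmn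
    · exact hv.kill m n hn
  weight n := by
    by_cases hn : (n : ℤ) ∈ S
    · exact hv.weight ⟨n, hn⟩
    · obtain ⟨f, hf, h0, -⟩ := hlam
      rw [hf, h0 n hn, Nat.cast_zero, zero_smul]
      exact hv.kill n n hn
  kill m n hn := hv.kill m n fun h => hn (hST.subset h)

end InitialSegments

section DominantWeights

variable {S T : Finset ℤ} {lam : Weight}

theorem lfin_isIrreducible (hlam : lam ∈ Pplus S) :
    LieModule.IsIrreducible ℂ (glS S) (LFin S lam) := by
  obtain ⟨p, hp, hw⟩ := exists_isHWInf hlam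
  exact hw.toIsHWFin.isIrreducible hp

theorem linf_isIrreducible (hlam : lam ∈ Pplus S) :
    LieModule.IsIrreducible ℂ gl (LInf S lam) := by
  obtain ⟨p, hp, hw⟩ := exists_isHWInf hlam
  exact hw.isIrreducible (fockForm _) hp

theorem linf_isPolynomial (hlam : lam ∈ Pplus S) : IsPolynomial (LInf S lam) := by
  obtain ⟨p, hp, hw⟩ := exists_isHWInf hlam
  obtain ⟨f, hf, -⟩ := hw.exists_hom (fockForm _) hp
  exact ⟨S, inferInstance, f, hf⟩

theorem lfinGen_ne_zero (hlam : lam ∈ Pplus S) : lfinGen S lam ≠ 0 := by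
  obtain ⟨p, hp, hw⟩ := exists_isHWInf hlam
  obtain ⟨f, -, hf⟩ := hw.toIsHWFin.exists_hom ((fockForm _).toFin S) hp
  exact fun h => hp (by rw [← hf, h, map_zero])

theorem linfGen_ne_zero (hlam : lam ∈ Pplus S) : linfGen S lam ≠ 0 := by
  obtain ⟨p, hp, hw⟩ := exists_isHWInf hlam
  obtain ⟨f, -, hf⟩ := hw.exists_hom (fockForm _) hp
  exact fun h => hp (by rw [← hf, h, map_zero])

theorem exists_weightSpan_linf (hlam : lam ∈ Pplus S) :
    ∃ d, weightSpan (LInf S lam) d = ⊤ := by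
  have hpol := linf_isPolynomial hlam
  obtain ⟨f, hf, h0, -⟩ := hlam
  let χ : ℤ →₀ ℕ := Finsupp.onFinset S f fun i hi => not_imp_comm.1 (h0 i) hi
  have hgen : IsWeight χ (linfGen S lam) := fun i => by
    change _ = (f i : ℂ) • _
    by_cases hi : i ∈ S
    · exact hf i ▸ (isHWInf_linfGen S lam).weight ⟨i, hi⟩
    · rw [(isHWInf_linfGen S lam).kill i i hi, h0 i hi, Nat.cast_zero, zero_smul]
  exact ⟨χ.degree, weightSpan_eq_top_of_lieSpan hpol hgen (lieSpan_linfGen S lam)⟩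

end DominantWeights

section Isomorphisms

variable {R L X Y : Type*} [CommRing R] [LieRing L] [LieAlgebra R L]
  [AddCommGroup X] [Module R X] [LieRingModule L X] [AddCommGroup Y] [Module R Y]
  [LieRingModule L Y]

omit [LieAlgebra R L] in
theorem nonempty_equiv_of_bijective (f : X →ₗ⁅R,L⁆ Y) (hf : Function.Bijective f) :
    Nonempty (X ≃ₗ⁅R,L⁆ Y) :=
  let e := LinearEquiv.ofBijective (f : X →ₗ[R] Y) hf
  ⟨{ f with invFun := e.symm, left_inv := e.left_inv, right_inv := e.right_inv }⟩

theorem nonempty_equiv_iff_exists_range_eq [LieModule R L X] [LieModule R L Y]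
    {N : LieSubmodule R L Y} :
    Nonempty (X ≃ₗ⁅R,L⁆ N) ↔ ∃ f : X →ₗ⁅R,L⁆ Y, Function.Injective f ∧ f.range = N := by
  constructor
  · rintro ⟨e⟩
    refine ⟨N.incl.comp e, Subtype.val_injective.comp e.injective, LieSubmodule.ext _ _ fun y => ?_⟩
    rw [LieModuleHom.mem_range]
    exact ⟨fun ⟨x, hx⟩ => hx ▸ (e x).2, fun hy => ⟨e.symm ⟨y, hy⟩,
      congrArg Subtype.val (e.apply_symm_apply ⟨y, hy⟩)⟩⟩
  · rintro ⟨f, hf, rfl⟩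
    refine nonempty_equiv_of_bijective
      (f.codRestrict f.range fun x => (f.mem_range _).2 ⟨x, rfl⟩) ⟨fun x y h => ?_, ?_⟩
    · exact hf (congrArg Subtype.val h)
    · rintro ⟨y, hy⟩
      obtain ⟨x, rfl⟩ := (f.mem_range y).1 hy
      exact ⟨x, rfl⟩

end Isomorphisms

section Supported

variable {M : Type*} [AddCommGroup M] [Module ℂ M] [LieRingModule gl M] [LieModule ℂ gl M]
  {M' : Type*} [AddCommGroup M'] [Module ℂ M'] [LieRingModule gl M'] [LieModule ℂ gl M']

theorem IsInitial.nonempty_lfin_equiv_supportedFin {S T : Finset ℤ} {lam : Weight}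
    (hST : IsInitial S T) (hlam : lam ∈ Pplus S) :
    Nonempty (LFin T lam ≃ₗ⁅ℂ,glS T⁆ supportedFin (LInf S lam) T) := by
  have hw := hST.isHWInf hlam (isHWInf_linfGen S lam)
  obtain ⟨B⟩ := (linf_isPolynomial hlam).nonempty_form
  obtain ⟨f, hf, hfv⟩ := hw.toIsHWFin.exists_hom (B.toFin T) (linfGen_ne_zero hlam)
  have hle : f.range ≤ supportedFin (LInf S lam) T := by
    rintro _ ⟨x, rfl⟩
    refine map_mem_of_lieSpan_eq_top (lieSpan_lfinGen T lam) f ?_ x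
    rw [hfv]
    exact hw.kill
  have hspan : LieSubmodule.lieSpan ℂ gl (f.range : Set (LInf S lam)) = ⊤ := by
    rw [eq_top_iff, ← lieSpan_linfGen]
    exact LieSubmodule.lieSpan_mono (Set.singleton_subset_iff.2 ⟨_, hfv⟩)
  refine nonempty_equiv_iff_exists_range_eq.2 ⟨f, hf, le_antisymm hle fun x hx => ?_⟩
  refine mem_of_mem_lieSpan B (V := f.range.toSubmodule) hle (fun m hm n hn y hy => ?_) hx
    (hspan ▸ LieSubmodule.mem_top x)
  exact f.range.lie_mem (x := EFin T ⟨m, hm⟩ ⟨n, hn⟩) hy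

theorem nonempty_supportedFin_equiv (e : M ≃ₗ⁅ℂ,gl⁆ M') (T : Finset ℤ) :
    Nonempty (supportedFin M T ≃ₗ⁅ℂ,glS T⁆ supportedFin M' T) := by
  let f : M →ₗ⁅ℂ,glS T⁆ M' := (e : M →ₗ⁅ℂ,gl⁆ M').restrictLie (glS T)
  refine nonempty_equiv_iff_exists_range_eq.2 ⟨f.comp (supportedFin M T).incl,
    e.injective.comp Subtype.val_injective, le_antisymm ?_ fun y hy => ?_⟩
  · rintro _ ⟨⟨x, hx⟩, rfl⟩ m n hn
    change ⁅E m n, e x⁆ = 0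
    rw [← LieModuleEquiv.coe_toLieModuleHom, ← LieModuleHom.map_lie, hx m n hn, map_zero]
  · refine ⟨⟨e.symm y, fun m n hn => e.injective ?_⟩, e.apply_symm_apply y⟩
    rw [← LieModuleEquiv.coe_toLieModuleHom, LieModuleHom.map_lie, map_zero,
      LieModuleEquiv.coe_toLieModuleHom, e.apply_symm_apply]
    exact hy m n hn

end Supported

section SupportedTensor

variable {M : Type*} [AddCommGroup M] [Module ℂ M] [LieRingModule gl M] [LieModule ℂ gl M]
  {M' : Type*} [AddCommGroup M'] [Module ℂ M'] [LieRingModule gl M'] [LieModule ℂ gl M']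
  {d d' : ℕ}

theorem map₂_mk_supportedIn_le (T : Set ℤ) :
    Submodule.map₂ (TensorProduct.mk ℂ M M') (supportedIn M T) (supportedIn M' T) ≤
      supportedIn (M ⊗[ℂ] M') T := by
  refine Submodule.map₂_le.2 fun x hx y hy m n hn => ?_
  rw [TensorProduct.mk_apply, TensorProduct.LieModule.lie_tmul_right, hx m n hn, hy m n hn,
    TensorProduct.zero_tmul, TensorProduct.tmul_zero, add_zero]

omit [LieModule ℂ gl M] in
theorem IsWeight.mem_outerPart {χ : ℤ →₀ ℕ} {x : M} (hx : IsWeight χ x) {T : Set ℤ} {i : ℤ}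
    (hi : i ∉ T) (h : χ i ≠ 0) : x ∈ outerPart M T := by
  have hE : ⁅E i i, x⁆ ∈ outerPart M T := lie_mem_outerPart hi i x
  rw [hx i] at hE
  exact ((outerPart M T).smul_mem_iff (Nat.cast_ne_zero.2 h)).1 hE

theorem supportedIn_tensor (hM : IsPolynomial M) (hM' : IsPolynomial M')
    (hd : weightSpan M d = ⊤) (hd' : weightSpan M' d' = ⊤) (T : Set ℤ) :
    supportedIn (M ⊗[ℂ] M') T =
      Submodule.map₂ (TensorProduct.mk ℂ M M') (supportedIn M T) (supportedIn M' T) := by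
  obtain ⟨B⟩ := (hM.tensor hM').nonempty_form
  have htop : Submodule.map₂ (TensorProduct.mk ℂ M M') (supportedIn M T) (supportedIn M' T) ⊔
      outerPart (M ⊗[ℂ] M') T = ⊤ := by
    refine eq_top_of_tmul_mem hd hd' fun χ ψ x y _ _ hx hy => ?_
    by_cases hout : ∀ i, i ∉ T → (χ + ψ) i = 0
    · refine Submodule.mem_sup_left (Submodule.apply_mem_map₂ _
        (hx.mem_supportedIn hM fun i hi => ?_) (hy.mem_supportedIn hM' fun i hi => ?_))
      · exact (Nat.add_eq_zero_iff.1 (hout i hi)).1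
      · exact (Nat.add_eq_zero_iff.1 (hout i hi)).2
    · push Not at hout
      obtain ⟨i, hi, h0⟩ := hout
      exact Submodule.mem_sup_right ((hx.tmul hy).mem_outerPart hi h0)
  rw [← sup_outerPart_inf_supportedIn B (map₂_mk_supportedIn_le T), htop, top_inf_eq]

variable {T : Finset ℤ}
  {X : Type*} [AddCommGroup X] [Module ℂ X] [LieRingModule (glS T) X] [LieModule ℂ (glS T) X]
  {X' : Type*} [AddCommGroup X'] [Module ℂ X'] [LieRingModule (glS T) X']
  [LieModule ℂ (glS T) X']

theorem nonempty_tensor_equiv_supportedFin (hM : IsPolynomial M) (hM' : IsPolynomial M')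
    (hd : weightSpan M d = ⊤) (hd' : weightSpan M' d' = ⊤)
    (hX : Nonempty (X ≃ₗ⁅ℂ,glS T⁆ supportedFin M T))
    (hX' : Nonempty (X' ≃ₗ⁅ℂ,glS T⁆ supportedFin M' T)) :
    Nonempty (X ⊗[ℂ] X' ≃ₗ⁅ℂ,glS T⁆ supportedFin (M ⊗[ℂ] M') T) := by
  obtain ⟨f, hf, hfr⟩ := nonempty_equiv_iff_exists_range_eq.1 hX
  obtain ⟨g, hg, hgr⟩ := nonempty_equiv_iff_exists_range_eq.1 hX'
  let θ : X ⊗[ℂ] X' →ₗ[ℂ] M ⊗[ℂ] M' := TensorProduct.map (f : X →ₗ[ℂ] M) (g : X' →ₗ[ℂ] M')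
  have hlie (a : glS T) (t) : θ ⁅a, t⁆ = ⁅(a : gl), θ t⁆ :=
    LieModuleHom.map_lie (TensorProduct.LieModule.map f g) a t
  refine nonempty_equiv_iff_exists_range_eq.2 ⟨{ θ with map_lie' := hlie _ _ },
    TensorProduct.map_injective_of_flat_flat _ _ hf hg, ?_⟩
  rw [← LieSubmodule.toSubmodule_inj]
  change LinearMap.range θ = supportedIn (M ⊗[ℂ] M') T
  rw [supportedIn_tensor hM hM' hd hd', TensorProduct.range_map]
  exact congrArg₂ (Submodule.map₂ _) (congrArg LieSubmodule.toSubmodule hfr)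
    (congrArg LieSubmodule.toSubmodule hgr)

end SupportedTensor

section SupportedDirectSum

variable {I : Type*} {M : I → Type*} [∀ i, AddCommGroup (M i)] [∀ i, Module ℂ (M i)]
  [∀ i, LieRingModule gl (M i)] [∀ i, LieModule ℂ gl (M i)]

theorem mem_supportedIn_directSum {T : Set ℤ} {x : ⨁ i, M i} :
    x ∈ supportedIn (⨁ i, M i) T ↔ ∀ i, x i ∈ supportedIn (M i) T := by
  have hlie (m n : ℤ) (i : I) : ⁅E m n, x⁆ i = ⁅E m n, x i⁆ :=
    DirectSum.lie_module_bracket_apply _ x i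
  refine ⟨fun hx i m n hn => ?_, fun hx m n hn => DFinsupp.ext fun i => ?_⟩
  · rw [← hlie, hx m n hn, DirectSum.zero_apply]
  · exact (hlie m n i).trans (hx i m n hn)

theorem nonempty_directSum_equiv_supportedFin {T : Finset ℤ} {X : I → Type*}
    [∀ i, AddCommGroup (X i)] [∀ i, Module ℂ (X i)] [∀ i, LieRingModule (glS T) (X i)]
    [∀ i, LieModule ℂ (glS T) (X i)]
    (h : ∀ i, Nonempty (X i ≃ₗ⁅ℂ,glS T⁆ supportedFin (M i) T)) :
    Nonempty ((⨁ i, X i) ≃ₗ⁅ℂ,glS T⁆ supportedFin (⨁ i, M i) T) := by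
  choose f hf hfr using fun i => nonempty_equiv_iff_exists_range_eq.1 (h i)
  let θ : (⨁ i, X i) →ₗ[ℂ] ⨁ i, M i := DFinsupp.mapRange.linearMap fun i => (f i : X i →ₗ[ℂ] M i)
  have hlie (a : glS T) (x) : θ ⁅a, x⁆ = ⁅(a : gl), θ x⁆ := DFinsupp.ext fun i => by
    change f i (⁅a, x⁆ i) = ⁅(a : gl), θ x⁆ i
    rw [DirectSum.lie_module_bracket_apply, LieModuleHom.map_lie,
      DirectSum.lie_module_bracket_apply]
    rfl
  refine nonempty_equiv_iff_exists_range_eq.2 ⟨{ θ with map_lie' := hlie _ _ },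
    (DFinsupp.mapRange_injective _ fun i => map_zero (f i)).2 hf,
    LieSubmodule.ext _ _ fun y => ?_⟩
  have hrange (i : I) : y i ∈ supportedIn (M i) T ↔ y i ∈ (f i).range := by rw [hfr i]; rfl
  change y ∈ LinearMap.range θ ↔ y ∈ supportedIn (⨁ i, M i) T
  rw [DFinsupp.range_mapRangeLinearMap, mem_supportedIn_directSum]
  exact ⟨fun h i => (hrange i).2 (h i trivial), fun h i _ => (hrange i).1 (h i)⟩

end SupportedDirectSum

section DirectSumDecomposition

theorem directSum_toModule_injective {R I X : Type*} {L : I → Type*} [Ring R] [DecidableEq I]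
    [∀ i, AddCommGroup (L i)] [∀ i, Module R (L i)] [AddCommGroup X] [Module R X]
    {f : ∀ i, L i →ₗ[R] X} (hf : ∀ i, Function.Injective (f i))
    (hind : iSupIndep fun i => LinearMap.range (f i)) :
    Function.Injective (DirectSum.toModule R I X f) := by
  have hcomp : DirectSum.toModule R I X f =
      DFinsupp.lsum ℕ (fun i => (LinearMap.range (f i)).subtype) ∘ₗ
        DFinsupp.mapRange.linearMap fun i => (f i).rangeRestrict := by
    refine DirectSum.linearMap_ext R fun i => LinearMap.ext fun x => ?_
    change DirectSum.toModule R I X f (DirectSum.lof R I L i x) =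
      DFinsupp.lsum ℕ (fun i => (LinearMap.range (f i)).subtype)
        (DFinsupp.mapRange.linearMap (fun i => (f i).rangeRestrict) (DFinsupp.single i x))
    rw [DirectSum.toModule_lof, DFinsupp.mapRange.linearMap_apply, DFinsupp.mapRange_single,
      DFinsupp.lsum_single]
    rfl
  rw [hcomp]
  exact hind.dfinsupp_lsum_injective.comp ((DFinsupp.mapRange_injective _ fun i => map_zero _).2
    fun i x y h => hf i (congrArg Subtype.val h))

variable {R L I X : Type*} [CommRing R] [LieRing L] [LieAlgebra R L] {M : I → Type*}
  [∀ i, AddCommGroup (M i)] [∀ i, Module R (M i)] [∀ i, LieRingModule L (M i)]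
  [∀ i, LieModule R L (M i)] [AddCommGroup X] [Module R X] [LieRingModule L X] [LieModule R L X]

/-- The homomorphism `⨁ i, M i → X` with components `f i`. -/
def directSumLift [DecidableEq I] (f : ∀ i, M i →ₗ⁅R,L⁆ X) : (⨁ i, M i) →ₗ⁅R,L⁆ X where
  toLinearMap := DirectSum.toModule R I X fun i => (f i : M i →ₗ[R] X)
  map_lie' {a x} := by
    suffices h : DirectSum.toModule R I X (fun i => (f i : M i →ₗ[R] X)) ∘ₗ
        LieModule.toEnd R L (⨁ i, M i) a =
        LieModule.toEnd R L X a ∘ₗ DirectSum.toModule R I X (fun i => (f i : M i →ₗ[R] X)) from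
      LinearMap.congr_fun h x
    refine DirectSum.linearMap_ext R fun i => LinearMap.ext fun y => ?_
    have hy : ⁅a, DirectSum.lof R I M i y⁆ = DirectSum.lof R I M i ⁅a, y⁆ :=
      ((DirectSum.lieModuleOf R I L M i).map_lie a y).symm
    simp only [LinearMap.comp_apply, LieModule.toEnd_apply_apply, hy, DirectSum.toModule_lof]
    exact (f i).map_lie a y

theorem nonempty_equiv_directSum_iff :
    Nonempty (X ≃ₗ⁅R,L⁆ ⨁ i, M i) ↔ ∃ f : ∀ i, M i →ₗ⁅R,L⁆ X, (∀ i, Function.Injective (f i)) ∧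
      iSupIndep (fun i => (f i).range) ∧ ⨆ i, (f i).range = ⊤ := by
  classical
  constructor
  · rintro ⟨e⟩
    let f (i : I) : M i →ₗ⁅R,L⁆ X :=
      (e.symm : (⨁ i, M i) →ₗ⁅R,L⁆ X).comp (DirectSum.lieModuleOf R I L M i)
    have hf (i : I) (x : M i) : e (f i x) = DirectSum.of M i x := e.apply_symm_apply _
    refine ⟨f, fun i => e.symm.injective.comp (DirectSum.of_injective i), fun i => ?_, ?_⟩
    · let g : X →ₗ⁅R,L⁆ M i :=
        (DirectSum.lieModuleComponent R I L M i).comp (e : X →ₗ⁅R,L⁆ ⨁ i, M i)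
      have hker : ⨆ (j) (_ : j ≠ i), (f j).range ≤ g.ker := by
        refine iSup₂_le fun j hj => ?_
        rintro _ ⟨x, rfl⟩
        exact (congrArg (fun y : ⨁ i, M i => y i) (hf j x)).trans
          (DirectSum.of_eq_of_ne j i x hj.symm)
      refine disjoint_iff.2 ((LieSubmodule.eq_bot_iff _).2 ?_)
      rintro _ ⟨⟨x, rfl⟩, hx⟩
      have hx0 : e (f i x) i = 0 := hker hx
      rw [hf, DirectSum.of_eq_same] at hx0
      rw [hx0]
      exact map_zero (f i)
    · refine eq_top_iff.2 fun x _ => ?_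
      rw [← e.symm_apply_apply x]
      induction e x using DirectSum.induction_on with
      | zero => rw [map_zero]; exact zero_mem _
      | of i y => exact LieSubmodule.mem_iSup_of_mem i ⟨y, rfl⟩
      | add y z hy hz => rw [map_add]; exact add_mem hy hz
  · rintro ⟨f, hf, hind, htop⟩
    refine (nonempty_equiv_of_bijective (directSumLift f) ⟨?_, ?_⟩).map LieModuleEquiv.symm
    · exact directSum_toModule_injective hf (LieSubmodule.iSupIndep_toSubmodule.2 hind)
    · rw [← LieModuleHom.range_eq_top, ← top_le_iff, ← htop]
      refine iSup_le fun i => ?_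
      rintro _ ⟨x, rfl⟩
      exact ⟨DirectSum.lof R I M i x, DirectSum.toModule_lof R i x⟩

end DirectSumDecomposition

section WeightVectors

variable {M : Type*} [AddCommGroup M] [Module ℂ M] [LieRingModule gl M] [LieModule ℂ gl M]
  {χ : ℤ →₀ ℕ} {d : ℕ}

theorem exists_common_eigenvector {K V κ : Type*} [Field K] [IsAlgClosed K] [AddCommGroup V]
    [Module K V] (f : κ → Module.End K V) (hf : ∀ i j, Commute (f i) (f j)) (s : Finset κ)
    {W : Submodule K V} [FiniteDimensional K W] (hW : W ≠ ⊥) (hst : ∀ i, ∀ v ∈ W, f i v ∈ W) :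
    ∃ v ∈ W, v ≠ 0 ∧ ∀ i ∈ s, ∃ c : K, f i v = c • v := by
  classical
  induction s using Finset.induction_on generalizing W with
  | empty =>
    obtain ⟨v, hv, h0⟩ := W.ne_bot_iff.1 hW
    exact ⟨v, hv, h0, by simp⟩
  | insert a s _ ih =>
    have : Nontrivial W := Submodule.nontrivial_iff_ne_bot.2 hW
    obtain ⟨c, hc⟩ := Module.End.exists_eigenvalue ((f a).restrict (hst a))
    obtain ⟨w, hw, hw0⟩ := hc.exists_hasEigenvector
    have hwc : (w : V) ∈ (f a).eigenspace c :=
      Module.End.mem_eigenspace_iff.2 (congrArg Subtype.val (Module.End.mem_eigenspace_iff.1 hw))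
    have hst' (i : κ) (v : V) (hv : v ∈ W ⊓ (f a).eigenspace c) :
        f i v ∈ W ⊓ (f a).eigenspace c :=
      ⟨hst i v hv.1, Module.End.mapsTo_genEigenspace_of_comm (hf a i) c 1 hv.2⟩
    have hne : W ⊓ (f a).eigenspace c ≠ ⊥ :=
      (Submodule.ne_bot_iff _).2 ⟨w, Submodule.mem_inf.2 ⟨w.2, hwc⟩, fun h => hw0 (Subtype.ext h)⟩
    obtain ⟨v, hv, h0, h⟩ := ih hne hst'
    refine ⟨v, hv.1, h0, (Finset.forall_mem_insert _ _ _).2 ⟨⟨c, ?_⟩, h⟩⟩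
    exact Module.End.mem_eigenspace_iff.1 hv.2

omit [LieModule ℂ gl M] in
theorem degree_eq_of_mem_support {J : Type} [Finite J] (hd : weightSpan M d = ⊤)
    (f : M →ₗ⁅ℂ,gl⁆ Pol J) {x : M} {α : ℤ × J →₀ ℕ} (hα : α ∈ (f x).support) : α.degree = d := by
  have hle : weightSpan M d ≤ (MvPolynomial.restrictSupport ℂ
      (Finsupp.degree ⁻¹' {d} : Set (ℤ × J →₀ ℕ))).comap (f : M →ₗ[ℂ] Pol J) := by
    refine Submodule.span_le.2 fun v ⟨χ, hχ, hv⟩ => ?_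
    refine (MvPolynomial.mem_restrictSupport_iff ..).2 fun β hβ => ?_
    have hfv (n : ℤ) : ⁅E n n, f v⁆ = (χ n : ℂ) • f v := by
      rw [← LieModuleHom.map_lie, hv n, map_smul]
    have hrow : rowDegree β = χ :=
      Finsupp.ext fun n => Nat.cast_injective (rowDegree_eq_of_lie_eq (hfv n) hβ)
    rw [Set.mem_preimage, Set.mem_singleton_iff, ← hχ, ← hrow, rowDegree, Finsupp.degree_mapDomain]
  exact hle (hd ▸ Submodule.mem_top : x ∈ weightSpan M d) hα

theorem IsPolynomial.finiteDimensional_supportedIn (hM : IsPolynomial M)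
    (hd : weightSpan M d = ⊤) (T : Finset ℤ) : FiniteDimensional ℂ (supportedIn M T) := by
  classical
  obtain ⟨J, _, f, hf⟩ := hM
  let F : Finset (ℤ × J →₀ ℕ) := (T ×ˢ Finset.univ).finsuppAntidiag d
  let P : Submodule ℂ (Pol J) := MvPolynomial.restrictSupport ℂ (F : Set (ℤ × J →₀ ℕ))
  have hmem (x : supportedIn M (T : Set ℤ)) : f x ∈ P := by
    refine (MvPolynomial.mem_restrictSupport_iff ..).2 fun α hα => ?_
    have hsupp : α.support ⊆ T ×ˢ Finset.univ := fun s hs => by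
      refine Finset.mem_product.2 ⟨?_, Finset.mem_univ _⟩
      by_contra hT
      refine Finsupp.mem_support_iff.1 hs (exponent_eq_zero_of_lie_eq_zero (p := f x) ?_ hα s.2)
      rw [← LieModuleHom.map_lie, x.2 _ _ hT, map_zero]
    refine Finset.mem_coe.2 (Finset.mem_finsuppAntidiag.2 ⟨?_, hsupp⟩)
    rw [← degree_eq_of_mem_support hd f hα, Finsupp.degree]
    exact (Finset.sum_subset hsupp fun s _ hs => Finsupp.notMem_support_iff.1 hs).symm
  have : FiniteDimensional ℂ P :=
    Module.Finite.of_basis (MvPolynomial.basisRestrictSupport ℂ (F : Set (ℤ × J →₀ ℕ)))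
  let g : supportedIn M (T : Set ℤ) →ₗ[ℂ] P :=
    ((f : M →ₗ[ℂ] Pol J) ∘ₗ (supportedIn M T).subtype).codRestrict P hmem
  exact Module.Finite.of_injective g fun x y h => Subtype.ext (hf (congrArg Subtype.val h))

theorem IsPolynomial.exists_isWeight (hM : IsPolynomial M) {v : M} (h0 : v ≠ 0)
    (hv : ∀ n, ∃ c : ℂ, ⁅E n n, v⁆ = c • v) : ∃ χ, IsWeight χ v := by
  obtain ⟨J, _, f, hf⟩ := hM
  obtain ⟨α, hα⟩ := MvPolynomial.ne_zero_iff.1 ((map_ne_zero_iff f hf).2 h0)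
  refine ⟨rowDegree α, fun n => ?_⟩
  obtain ⟨c, hc⟩ := hv n
  rw [hc, rowDegree_eq_of_lie_eq (p := f v) (by rw [← LieModuleHom.map_lie, hc, map_smul])
    (MvPolynomial.mem_support_iff.2 hα)]

omit [LieModule ℂ gl M] in
theorem ContraForm.form_self_re_nonneg (B : ContraForm E M) (x : M) : 0 ≤ (B.form x x).re := by
  rcases eq_or_ne x 0 with rfl | hx
  · rw [map_zero, Complex.zero_re]
  · exact (B.pos x hx).le

omit [LieModule ℂ gl M] in
theorem IsWeight.le_of_lie_eq_zero (B : ContraForm E M) {v : M} (hv : IsWeight χ v) (h0 : v ≠ 0)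
    {i j : ℤ} (h : ⁅E i j, v⁆ = 0) : χ j ≤ χ i := by
  have hji : ⁅E i j, ⁅E j i, v⁆⁆ = ((χ i : ℂ) - χ j) • v := by
    rw [leibniz_lie, h, lie_zero, add_zero, E_lie, if_pos rfl, if_pos rfl, sub_lie, hv i, hv j,
      sub_smul]
  have hform : (B.form ⁅E j i, v⁆ ⁅E j i, v⁆).re = ((χ i : ℝ) - χ j) * (B.form v v).re := by
    rw [B.contra, hji, map_smul, smul_eq_mul, Complex.mul_re]
    simp
  have hnonneg := B.form_self_re_nonneg ⁅E j i, v⁆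
  rw [hform, mul_nonneg_iff_of_pos_right (B.pos v h0), sub_nonneg] at hnonneg
  exact_mod_cast hnonneg

end WeightVectors

section SingularVectors

/-- The `i`-th diagonal entry of a matrix. -/
def diagEntry (i : ℤ) : Module.End ℂ Vec →ₗ[ℂ] ℂ :=
  Finsupp.lapply i ∘ₗ LinearMap.applyₗ (unitVec i)

/-- The weight `λ` with `λ_i = χ i`. -/
def weightOf (χ : ℤ →₀ ℕ) : Weight :=
  (∑ i ∈ χ.support, (χ i : ℂ) • diagEntry i) ∘ₗ gl.toSubmodule.subtype ∘ₗ cartan.subtype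

theorem diagEntry_unit (i n : ℤ) : diagEntry i (unit n n) = if i = n then 1 else 0 := by
  change (Finsupp.lapply i : (ℤ →₀ ℂ) →ₗ[ℂ] ℂ) (unit n n (unitVec i)) = _
  rw [unit_unitVec]
  split_ifs with h h' h'
  · exact h ▸ Finsupp.single_eq_same
  · exact absurd h.symm h'
  · exact absurd h'.symm h
  · exact map_zero (Finsupp.lapply i : (ℤ →₀ ℂ) →ₗ[ℂ] ℂ)

theorem weightOf_val (χ : ℤ →₀ ℕ) (n : ℤ) : (weightOf χ).val n = χ n := by
  change (∑ i ∈ χ.support, (χ i : ℂ) • diagEntry i) (unit n n) = _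
  simp only [LinearMap.sum_apply, LinearMap.smul_apply, diagEntry_unit, smul_eq_mul, mul_ite,
    mul_one, mul_zero, Finset.sum_ite_eq', Finsupp.mem_support_iff, ite_eq_left_iff, not_not]
  exact fun h => by rw [h, Nat.cast_zero]

variable {M : Type*} [AddCommGroup M] [Module ℂ M] [LieRingModule gl M] [LieModule ℂ gl M]
  {T : Finset ℤ} {χ : ℤ →₀ ℕ} {d : ℕ}

theorem IsWeight.apply_eq_zero {v : M} (hv : IsWeight χ v) (h0 : v ≠ 0) {S : Set ℤ}
    (hS : v ∈ supportedIn M S) {n : ℤ} (hn : n ∉ S) : χ n = 0 := by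
  have h := hS n n hn
  rw [hv n, smul_eq_zero, Nat.cast_eq_zero] at h
  exact h.resolve_right h0

theorem IsWeight.exists_isHWFin (B : ContraForm E M) {v : M} (hv : IsWeight χ v) (h0 : v ≠ 0)
    (hT : v ∈ supportedIn M T) (hraise : ∀ m ∈ T, ∀ n ∈ T, m < n → ⁅E m n, v⁆ = 0) :
    ∃ nu ∈ Pplus T, IsHWFin T nu v := by
  refine ⟨weightOf χ, ⟨χ, weightOf_val χ, fun n hn => hv.apply_eq_zero h0 hT hn,
    fun i hi j hj hij => hv.le_of_lie_eq_zero B h0 (hraise i hi j hj hij)⟩,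
    fun m n hmn => hraise m m.2 n n.2 hmn, fun n => ?_⟩
  rw [weightOf_val]
  exact hv n

theorem exists_isWeight_mem (hM : IsPolynomial M) (hd : weightSpan M d = ⊤) {W : Submodule ℂ M}
    (hW : W ≠ ⊥) (hWT : W ≤ supportedIn M T) (hst : ∀ n ∈ T, ∀ x ∈ W, ⁅E n n, x⁆ ∈ W) :
    ∃ v ∈ W, v ≠ 0 ∧ ∃ χ, IsWeight χ v := by
  have := hM.finiteDimensional_supportedIn hd T
  have := Submodule.finiteDimensional_of_le hWT
  have hcomm (i j : ℤ) :
      Commute (LieModule.toEnd ℂ gl M (E i i)) (LieModule.toEnd ℂ gl M (E j j)) := by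
    rw [commute_iff_lie_eq, ← LieHom.map_lie, E_lie]
    split_ifs with hij
    · rw [hij, sub_self, map_zero]
    · rw [sub_self, map_zero]
  obtain ⟨v, hv, h0, hc⟩ := exists_common_eigenvector
    (fun n : ℤ => LieModule.toEnd ℂ gl M (E n n)) hcomm T hW fun n x hx => by
      by_cases hn : n ∈ T
      · exact hst n hn x hx
      · rw [LieModule.toEnd_apply_apply, hWT hx n n hn]
        exact zero_mem _
  refine ⟨v, hv, h0, hM.exists_isWeight h0 fun n => ?_⟩
  by_cases hn : n ∈ T
  · exact hc n hn
  · exact ⟨0, by rw [hWT hv n n hn, zero_smul]⟩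

/-- Raising operators move a weight to the left, so a weight vector whose weight lies as far to the
left as possible is killed by them. -/
theorem exists_isHWFin (hM : IsPolynomial M) (hd : weightSpan M d = ⊤) {W : Submodule ℂ M}
    (hW : W ≠ ⊥) (hWT : W ≤ supportedIn M T)
    (hst : ∀ m ∈ T, ∀ n ∈ T, ∀ x ∈ W, ⁅E m n, x⁆ ∈ W) :
    ∃ v ∈ W, v ≠ 0 ∧ ∃ nu ∈ Pplus T, IsHWFin T nu v := by
  obtain ⟨B⟩ := hM.nonempty_form
  obtain ⟨a, ha⟩ := T.bddBelow
  let position : (ℤ →₀ ℕ) →+ ℕ := Finsupp.weight fun i : ℤ => (i - a).toNat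
  obtain ⟨χ, ⟨v, hv, h0, hχ⟩, hmin⟩ := exists_minimalFor_of_wellFoundedLT
    (fun χ : ℤ →₀ ℕ => ∃ v ∈ W, v ≠ 0 ∧ IsWeight χ v) position (by
      obtain ⟨v, hv, h0, χ, hχ⟩ := exists_isWeight_mem hM hd hW hWT fun n hn => hst n hn n hn
      exact ⟨χ, v, hv, h0, hχ⟩)
  refine ⟨v, hv, h0, hχ.exists_isHWFin B h0 (hWT hv) fun m hm n hn hmn => ?_⟩
  by_contra hne
  have hn0 : χ n ≠ 0 := fun h =>
    hne (hM.lie_eq_zero (by rw [hχ n, h, Nat.cast_zero, zero_smul]) m)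
  obtain ⟨ψ, rfl⟩ := exists_add_single hn0
  have hle := hmin ⟨_, hst m hm n hn v hv, hne, hχ.lie m⟩
  have ham : a ≤ m := ha hm
  simp only [map_add, Finsupp.weight_single, smul_eq_mul, one_mul, add_le_add_iff_left,
    Int.toNat_le, Int.ofNat_toNat, le_sup_iff, tsub_le_iff_right, sub_add_cancel, zero_add,
    position] at hle
  omega

end SingularVectors

section CompleteReducibility

variable {ι L M : Type*} [DecidableEq ι] [LieRing L] [LieAlgebra ℂ L] [AddCommGroup M] [Module ℂ M]
  [LieRingModule L M] [LieModule ℂ L M] {e : ι → ι → L} [FiniteDimensional ℂ M]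

theorem ContraForm.orthogonal_ne_bot (B : ContraForm e M) (he : IsGlFamily e)
    {N : LieSubmodule ℂ L M} (hN : N ≠ ⊤) : B.orthogonal he N ≠ ⊥ := by
  let b := Module.finBasis ℂ N.toSubmodule
  let g : M →ₗ[ℂ] (Fin (Module.finrank ℂ N.toSubmodule) → ℂ) := LinearMap.pi fun i => B.form (b i)
  have hlt : Module.finrank ℂ N.toSubmodule < Module.finrank ℂ M :=
    Submodule.finrank_lt (by rwa [Ne, LieSubmodule.toSubmodule_eq_top])
  obtain ⟨y, hy, hy0⟩ := (Submodule.ne_bot_iff _).1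
    (LinearMap.ker_ne_bot_of_finrank_lt (f := g) (by rwa [Module.finrank_fin_fun]))
  have hform : (B.form.flip y).domRestrict N.toSubmodule = 0 := b.ext fun i => congrFun hy i
  intro hbot
  refine hy0 ((LieSubmodule.mem_bot (R := ℂ) (L := L) y).1 (hbot ▸ ?_))
  exact (B.mem_orthogonal he).2 fun x hx => LinearMap.congr_fun hform ⟨x, hx⟩

theorem ContraForm.exists_finite_sSupIndep_atoms (B : ContraForm e M) (he : IsGlFamily e) :
    ∃ s : Set (LieSubmodule ℂ L M), s.Finite ∧ (∀ a ∈ s, IsAtom a) ∧ sSupIndep s ∧ sSup s = ⊤ := by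
  have htop : sSup {a : LieSubmodule ℂ L M | IsAtom a} = ⊤ := by
    by_contra h
    obtain ⟨a, ha, hle⟩ := (IsAtomic.eq_bot_or_exists_atom_le _).resolve_left
      (B.orthogonal_ne_bot he h)
    refine ha.1 ((LieSubmodule.eq_bot_iff _).2 fun x hx => ?_)
    exact B.eq_zero (hle hx x ((le_sSup ha : a ≤ _) hx))
  obtain ⟨s, hind, hcompl, hatom⟩ := exists_sSupIndep_isCompl_sSup_atoms htop ⊥
  exact ⟨s, WellFoundedGT.finite_of_sSupIndep hind, fun a ha => hatom ha, hind,
    bot_sup_eq (sSup s) ▸ hcompl.sup_eq_top⟩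

end CompleteReducibility

section Decomposition

variable {M : Type*} [AddCommGroup M] [Module ℂ M] [LieRingModule gl M] [LieModule ℂ gl M]
  {d : ℕ} {T : Finset ℤ}

theorem exists_range_eq_of_isAtom (hM : IsPolynomial M) (hd : weightSpan M d = ⊤)
    {a : LieSubmodule ℂ (glS T) (supportedFin M T)} (ha : IsAtom a) :
    ∃ nu ∈ Pplus T, ∃ f : LFin T nu →ₗ⁅ℂ,glS T⁆ supportedFin M T,
      Function.Injective f ∧ f.range = a := by
  obtain ⟨B⟩ := hM.nonempty_form
  let W : LieSubmodule ℂ (glS T) M := a.map (supportedFin M T).incl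
  have hW : W.toSubmodule ≠ ⊥ := fun h => ha.1 <| (LieSubmodule.eq_bot_iff _).2 fun x hx =>
    Subtype.ext ((Submodule.eq_bot_iff _).1 h x (LieSubmodule.mem_map_of_mem hx))
  have hWT : W.toSubmodule ≤ supportedIn M T := by
    rintro _ ⟨x, -, rfl⟩
    exact x.2
  obtain ⟨_, ⟨v, hva, rfl⟩, h0, nu, hnu, hv⟩ := exists_isHWFin hM hd hW hWT
    fun m hm n hn x hx => W.lie_mem (x := EFin T ⟨m, hm⟩ ⟨n, hn⟩) hx
  have hv' : IsHWFin T nu v :=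
    ⟨fun m n h => Subtype.ext (hv.raise m n h), fun n => Subtype.ext (hv.weight n)⟩
  have hv0 : v ≠ 0 := fun h => h0 (by rw [h, map_zero])
  obtain ⟨f, hf, hfv⟩ := hv'.exists_hom
    ((B.toFin T).comap (supportedFin M T).incl Subtype.val_injective) hv0
  refine ⟨nu, hnu, f, hf, (ha.le_iff.1 ?_).resolve_left fun h => hv0 ?_⟩
  · rintro _ ⟨x, rfl⟩
    exact map_mem_of_lieSpan_eq_top (lieSpan_lfinGen T nu) f (by rwa [hfv]) x
  · exact (LieSubmodule.mem_bot v).1 (h ▸ (f.mem_range v).2 ⟨_, hfv⟩)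

theorem exists_decomposition (hM : IsPolynomial M) (hd : weightSpan M d = ⊤) (T : Finset ℤ) :
    ∃ (N : ℕ) (nu : Fin N → Weight), (∀ i, nu i ∈ Pplus T) ∧
      Nonempty (supportedFin M T ≃ₗ⁅ℂ,glS T⁆ ⨁ i, LFin T (nu i)) := by
  obtain ⟨B⟩ := hM.nonempty_form
  have : FiniteDimensional ℂ (supportedFin M T) := hM.finiteDimensional_supportedIn hd T
  obtain ⟨s, hfin, hatom, hind, htop⟩ := ((B.toFin T).comap (supportedFin M T).incl
    Subtype.val_injective).exists_finite_sSupIndep_atoms (isGlFamily_EFin T)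
  choose nu hnu f hf hrange using fun a : s => exists_range_eq_of_isAtom hM hd (hatom a a.2)
  have := hfin.to_subtype
  obtain ⟨N, ⟨e⟩⟩ := Finite.exists_equiv_fin s
  refine ⟨N, fun i => nu (e.symm i), fun i => hnu _,
    nonempty_equiv_directSum_iff.2 ⟨fun i => f (e.symm i), fun i => hf _, ?_, ?_⟩⟩
  · simp only [hrange]
    exact ((sSupIndep_iff s).1 hind).comp e.symm.injective
  · simp only [hrange]
    rw [e.symm.iSup_comp (g := fun a : s => (a : LieSubmodule ℂ (glS T) (supportedFin M T))),
      ← sSup_eq_iSup', htop]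

end Decomposition

section Comparison

variable {M : Type*} [AddCommGroup M] [Module ℂ M] [LieRingModule gl M] [LieModule ℂ gl M]
  {d : ℕ} {T : Finset ℤ}

theorem disjoint_range_of_notMem {R L Q X : Type*} [CommRing R] [LieRing L] [LieAlgebra R L]
    [AddCommGroup Q] [Module R Q] [LieRingModule L Q] [LieModule R L Q]
    [LieModule.IsIrreducible R L Q] [AddCommGroup X] [Module R X] [LieRingModule L X]
    [LieModule R L X] (f : Q →ₗ⁅R,L⁆ X) {N : LieSubmodule R L X} {q : Q} (h : f q ∉ N) :
    Disjoint f.range N := by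
  have hbot : N.comap f = ⊥ := (eq_bot_or_eq_top _).resolve_right fun htop =>
    h (htop ▸ LieSubmodule.mem_top q : q ∈ N.comap f)
  refine disjoint_iff.2 ((LieSubmodule.eq_bot_iff _).2 ?_)
  rintro _ ⟨⟨x, rfl⟩, hx⟩
  have hx0 : x ∈ (⊥ : LieSubmodule R L Q) := hbot ▸ LieSubmodule.mem_comap.2 hx
  rw [(LieSubmodule.mem_bot x).1 hx0]
  exact map_zero f

theorem mem_of_coe_mem_lieSpan (B : ContraForm E M)
    {N : LieSubmodule ℂ (glS T) (supportedFin M T)} {x : supportedFin M T}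
    (hx : (x : M) ∈ LieSubmodule.lieSpan ℂ gl (N.map (supportedFin M T).incl : Set M)) :
    x ∈ N := by
  have hle : (N.map (supportedFin M T).incl).toSubmodule ≤ supportedIn M T := by
    rintro _ ⟨y, -, rfl⟩
    exact y.2
  obtain ⟨y, hy, hyx⟩ := mem_of_mem_lieSpan B hle
    (fun m hm n hn y hy => LieSubmodule.lie_mem _ (x := EFin T ⟨m, hm⟩ ⟨n, hn⟩) hy) x.2 hx
  exact Subtype.ext hyx ▸ hy

theorem IsHWFin.isHWInf {nu : Weight} {x : supportedFin M T} (hx : IsHWFin T nu x) :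
    IsHWInf T nu (x : M) :=
  ⟨hx.map (supportedFin M T).incl, x.2⟩

/-- A decomposition of `supportedFin M T` induces one of `M`: the summands of `M` are generated by
the highest weight vectors of the summands of `supportedFin M T`. -/
theorem nonempty_equiv_directSum_linf (hM : IsPolynomial M) (hd : weightSpan M d = ⊤)
    (hT : d ≤ T.card) {I : Type*} {nu : I → Weight} (hnu : ∀ i, nu i ∈ Pplus T)
    (h : Nonempty (supportedFin M T ≃ₗ⁅ℂ,glS T⁆ ⨁ i, LFin T (nu i))) :
    Nonempty (M ≃ₗ⁅ℂ,gl⁆ ⨁ i, LInf T (nu i)) := by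
  obtain ⟨B⟩ := hM.nonempty_form
  obtain ⟨f, hf, hind, htop⟩ := nonempty_equiv_directSum_iff.1 h
  let v (i : I) : supportedFin M T := f i (lfinGen T (nu i))
  have hv (i : I) : v i ≠ 0 := (map_ne_zero_iff (f i) (hf i)).2 (lfinGen_ne_zero (hnu i))
  have hw (i : I) : IsHWInf T (nu i) (v i : M) := ((isHWFin_lfinGen T (nu i)).map (f i)).isHWInf
  choose F hF hFv using fun i => (hw i).exists_hom B fun h0 => hv i (Subtype.ext h0)
  have hrange_le {i : I} {N : LieSubmodule ℂ gl M} (hN : (v i : M) ∈ N) : (F i).range ≤ N := by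
    rintro _ ⟨x, rfl⟩
    exact map_mem_of_lieSpan_eq_top (lieSpan_linfGen T (nu i)) (F i) (by rwa [hFv]) x
  refine nonempty_equiv_directSum_iff.2 ⟨F, hF, fun i => ?_, ?_⟩
  · have := linf_isIrreducible (hnu i)
    refine disjoint_range_of_notMem (F i) (q := linfGen T (nu i)) fun hi => hv i ?_
    have hvi : v i ∈ ⨆ (j) (_ : j ≠ i), (f j).range := by
      refine mem_of_coe_mem_lieSpan B (hFv i ▸ iSup₂_le (fun j hj => hrange_le ?_) hi)
      refine LieSubmodule.subset_lieSpan (LieSubmodule.mem_map_of_mem ?_)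
      exact le_iSup₂ (f := fun j (_ : j ≠ i) => (f j).range) j hj ⟨_, rfl⟩
    exact (LieSubmodule.mem_bot _).1 ((hind i).le_bot ⟨⟨_, rfl⟩, hvi⟩)
  · set V : LieSubmodule ℂ gl M := ⨆ i, (F i).range
    have hle : ⊤ ≤ (V.restr (glS T)).comap (supportedFin M T).incl := by
      rw [← htop]
      refine iSup_le fun i => ?_
      rintro _ ⟨x, rfl⟩
      refine map_mem_of_lieSpan_eq_top (lieSpan_lfinGen T (nu i)) (f i) ?_ x
      exact le_iSup (fun i => (F i).range) i ⟨_, hFv i⟩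
    refine (LieSubmodule.toSubmodule_eq_top _).1 (eq_top_of_supportedIn_le hM hd
      (T := T) ?_ (fun x hx => hle (LieSubmodule.mem_top ⟨x, hx⟩)) fun i t _ x hx => V.lie_mem hx)
    rwa [Set.encard_coe_eq_coe_finsetCard, Nat.cast_le]

theorem nonempty_equiv_directSum_linf_iff (hM : IsPolynomial M) (hd : weightSpan M d = ⊤)
    (hT : d ≤ T.card) {I : Type*} {nu : I → Weight} (hnu : ∀ i, nu i ∈ Pplus T) :
    Nonempty (M ≃ₗ⁅ℂ,gl⁆ ⨁ i, LInf T (nu i)) ↔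
      Nonempty (supportedFin M T ≃ₗ⁅ℂ,glS T⁆ ⨁ i, LFin T (nu i)) := by
  refine ⟨fun ⟨e⟩ => ?_, nonempty_equiv_directSum_linf hM hd hT hnu⟩
  obtain ⟨e₁⟩ := nonempty_supportedFin_equiv e T
  obtain ⟨e₂⟩ := nonempty_directSum_equiv_supportedFin fun i =>
    (IsInitial.refl T).nonempty_lfin_equiv_supportedFin (hnu i)
  exact ⟨e₁.trans e₂.symm⟩

end Comparison

section TensorProducts

variable {S T : Finset ℤ} {lam mu : Weight}

theorem finDecomp_iff (hST : IsInitial S T) (hlam : lam ∈ Pplus S) (hmu : mu ∈ Pplus S) {I : Type}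
    {nu : I → Weight} : FinDecomp T lam mu nu ↔ Nonempty
      (supportedFin (LInf S lam ⊗[ℂ] LInf S mu) T ≃ₗ⁅ℂ,glS T⁆ ⨁ i, LFin T (nu i)) := by
  obtain ⟨d, hd⟩ := exists_weightSpan_linf hlam
  obtain ⟨d', hd'⟩ := exists_weightSpan_linf hmu
  obtain ⟨e⟩ := nonempty_tensor_equiv_supportedFin (linf_isPolynomial hlam)
    (linf_isPolynomial hmu) hd hd' (hST.nonempty_lfin_equiv_supportedFin hlam)
    (hST.nonempty_lfin_equiv_supportedFin hmu)
  exact ⟨fun ⟨e'⟩ => ⟨e.symm.trans e'⟩, fun ⟨e'⟩ => ⟨e.trans e'⟩⟩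

theorem infDecomp_iff_finDecomp {d : ℕ} (hST : IsInitial S T) (hlam : lam ∈ Pplus S)
    (hmu : mu ∈ Pplus S) (hd : weightSpan (LInf S lam ⊗[ℂ] LInf S mu) d = ⊤) (hT : d ≤ T.card)
    {I : Type} {nu : I → Weight} (hnu : ∀ i, nu i ∈ Pplus T) :
    InfDecomp S T lam mu nu ↔ FinDecomp T lam mu nu :=
  (nonempty_equiv_directSum_linf_iff ((linf_isPolynomial hlam).tensor (linf_isPolynomial hmu))
    hd hT hnu).trans (finDecomp_iff hST hlam hmu).symm

end TensorProducts

end GlInfty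

end

open GlInfty in
theorem theorem4p4_general {S : Finset ℤ} {lam mu : Weight} (hlam : lam ∈ Pplus S)
    (hmu : mu ∈ Pplus S) :
    IsCyclicModule gl (LInf S lam ⊗[ℂ] LInf S mu) ∧
    ∃ d : ℕ, ∀ T : Finset ℤ, IsInitial S T → d ≤ T.card →
      (∃ (N : ℕ) (nu : Fin N → Weight),
        (∀ i, nu i ∈ Pplus T) ∧
        (∀ i, LieModule.IsIrreducible ℂ gl (LInf T (nu i))) ∧
        (∀ i, LieModule.IsIrreducible ℂ (glS T) (LFin T (nu i))) ∧
        InfDecomp S T lam mu nu ∧ FinDecomp T lam mu nu) ∧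
      ∀ (I : Type) (nu : I → Weight), (∀ i, nu i ∈ Pplus T) →
        (InfDecomp S T lam mu nu ↔ FinDecomp T lam mu nu) := by
  have hpol := linf_isPolynomial hlam
  have hpol' := linf_isPolynomial hmu
  have := linf_isIrreducible hlam
  have := linf_isIrreducible hmu
  obtain ⟨d, hd⟩ := exists_weightSpan_linf hlam
  obtain ⟨d', hd'⟩ := exists_weightSpan_linf hmu
  have hdd' := weightSpan_tensor hd hd'
  refine ⟨isCyclicModule_tensor hpol hpol' hd hd', d + d', fun T hST hT => ?_⟩
  have hiff {I : Type} {nu : I → Weight} (hnu : ∀ i, nu i ∈ Pplus T) :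
      InfDecomp S T lam mu nu ↔ FinDecomp T lam mu nu :=
    infDecomp_iff_finDecomp hST hlam hmu hdd' hT hnu
  obtain ⟨N, nu, hnu, hdecomp⟩ := exists_decomposition (hpol.tensor hpol') hdd' T
  have hfin : FinDecomp T lam mu nu := (finDecomp_iff hST hlam hmu).2 hdecomp
  exact ⟨⟨N, nu, hnu, fun i => linf_isIrreducible (hnu i), fun i => lfin_isIrreducible (hnu i),
    (hiff hnu).2 hfin, hfin⟩, fun _ _ hnu => hiff hnu⟩

theorem theorem4p4 (r n : ℤ) (hrn : r ≤ n) (lam mu : GlInfty.Weight)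
    (hlam : lam ∈ GlInfty.Pplus (Finset.Icc r n)) (hmu : mu ∈ GlInfty.Pplus (Finset.Icc r n)) :
    GlInfty.IsCyclicModule GlInfty.gl
      (GlInfty.LInf (Finset.Icc r n) lam ⊗[ℂ] GlInfty.LInf (Finset.Icc r n) mu) ∧
    ∃ k : ℤ, n ≤ k ∧ ∀ nbar : ℤ, k ≤ nbar →
      (∃ (N : ℕ) (nu : Fin N → GlInfty.Weight),
        (∀ i, nu i ∈ GlInfty.Pplus (Finset.Icc r nbar)) ∧
        (∀ i, LieModule.IsIrreducible ℂ GlInfty.gl (GlInfty.LInf (Finset.Icc r nbar) (nu i))) ∧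
        (∀ i, LieModule.IsIrreducible ℂ (GlInfty.glS (Finset.Icc r nbar))
          (GlInfty.LFin (Finset.Icc r nbar) (nu i))) ∧
        GlInfty.InfDecomp (Finset.Icc r n) (Finset.Icc r nbar) lam mu nu ∧
        GlInfty.FinDecomp (Finset.Icc r nbar) lam mu nu) ∧
      ∀ (I : Type) (nu : I → GlInfty.Weight),
        (∀ i, nu i ∈ GlInfty.Pplus (Finset.Icc r nbar)) →
        (GlInfty.InfDecomp (Finset.Icc r n) (Finset.Icc r nbar) lam mu nu ↔
          GlInfty.FinDecomp (Finset.Icc r nbar) lam mu nu) := by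
  obtain ⟨hcyclic, d, hdecomp⟩ := theorem4p4_general hlam hmu
  exact ⟨hcyclic, max n (r + d), le_max_left _ _, fun nbar hk => hdecomp (Finset.Icc r nbar)
    (GlInfty.isInitial_Icc ((le_max_left _ _).trans hk)) (by rw [Int.card_Icc]; omega)⟩
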